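/- Let $\mathbf X=\{(X_1(t),\dots,X_r(t)):t\in\mathbb R\}$ be a real vector-valued, zero mean, mean square continuous stationary process with covariances $C_{a_1a_2}(\tau)=E[X_{a_1}(t+\tau)X_{a_2}(t)]$. For a sample size $n\ge1$, a kernel $K$, a bandwidth $b_n>0$ and a sampling rate $\rho_n>0$ put $$\widehat\phi_{a_1a_2}(\lambda)=\frac1{2\pi n\rho_n}\sum_{t_1=1}^n\sum_{t_2=1}^nK(b_n(t_1-t_2))\,X_{a_1}\!\Big(\frac{t_1}{\rho_n}\Big)X_{a_2}\!\Big(\frac{t_2}{\rho_n}\Big)e^{-i(t_1-t_2)\lambda/\rho_n}\,1_{[-\pi\rho_n,\pi\rho_n]}(\lambda).$$ The joint cumulant of real or complex random variables $Y_1,\dots,Y_k$ is $$\mathrm{cum}(Y_1,\dots,Y_k)=\sum_{\{\nu_1,\dots,\nu_p\}}(-1)^{p-1}(p-1)!\prod_{q=1}^pE\Big[\prod_{j\in\nu_q}Y_j\Big],$$ the sum being over all partitions of $\{1,\dots,k\}$ into nonempty blocks. Assume: 1. For all $a_1,a_2\in\{1,\dots,r\}$ the function $t\mapsto\sup_{|s|\ge|t|}|C_{a_1a_2}(s)|$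 is integrable over $\mathbb R$. 2. $K:\mathbb R\to\mathbb R$ is continuous, even and square integrable, $K(0)=1$, and $|K|\le K_1$ for some nonnegative, even, integrable function $K_1$ that is unimodal with a unique maximum at $0$ (that is, $K_1$ is non-increasing on $[0,\infty)$ and $K_1(x)<K_1(0)$ for $x\ne0$). 3. $nb_n\to\infty$ as $n\to\infty$. 4. $\rho_n\to\infty$ and $\rho_nb_n\to0$ as $n\to\infty$. 5. $\mathbf X$ is strictly stationary; $E[X_a(t)^k]$ exists and is finite for all $k>2$, all $a$ and all $t$; and for every $k>2$ and all $a_1,\dots,a_k\in\{1,\dots,r\}$ there are continuous, even, nonnegative, integrable functions $g_1,\dots,g_{k-1}$ on $\mathbb R$, non-increasing on $(0,\infty)$, such that for all $t_1,\dots,t_{k-1},t\in\mathbb R$ $$\big|\mathrm{cum}\big(X_{a_1}(t_1+t),\dots,X_{a_{k-1}}(t_{k-1}+t),X_{a_k}(t)\big)\big|\le\prod_{i=1}^{k-1}g_i(t_i).$$ Then for every $L>2$ and all $a_1,\dots,a_{2L}\in\{1,\dots,r\}$ there is a constant $Q$, not depending on $n$ or on the frequencies, such that for all $n\ge1$ and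 all $\lambda_1,\dots,\lambda_L\in\mathbb R$ $$\Big|\mathrm{cum}\big(\widehat\phi_{a_1a_2}(\lambda_1),\dots,\widehat\phi_{a_{2L-1}a_{2L}}(\lambda_L)\big)\Big|\le Q\,(nb_n)^{-(L-1)}.$$ -/

import Mathlib

open MeasureTheory ProbabilityTheory Filter Topology

noncomputable section

/-- Joint cumulant of a finite family of real or complex random variables: the sum over all
partitions `π = {B₁, …, B_p}` of the index set of
`(-1)^(p-1) (p-1)! (E ∏_{j ∈ B₁} Y_j) ⋯ (E ∏_{j ∈ B_p} Y_j)` (no complex conjugation). -/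
def jointCumulant {Ω : Type*} [MeasurableSpace Ω] (μ : Measure Ω)
    {𝕜 : Type*} [RCLike 𝕜] {k : ℕ} (Y : Fin k → Ω → 𝕜) : 𝕜 :=
  ∑ π : Finpartition (Finset.univ : Finset (Fin k)),
    (-1 : 𝕜) ^ (π.parts.card - 1) * (Nat.factorial (π.parts.card - 1) : 𝕜) *
      ∏ B ∈ π.parts, ∫ ω, ∏ j ∈ B, Y j ω ∂μ

/-- A zero mean, mean square continuous, (second order) stationary process with `r` real
components, indexed by continuous time; `X a t` is the random variable `X_a(t)`. -/
structure IsMeanSquareContinuousStationary {Ω : Type*} [MeasurableSpace Ω] (μ : Measure Ω)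
    {r : ℕ} (X : Fin r → ℝ → Ω → ℝ) : Prop where
  measurable : ∀ a t, Measurable (X a t)
  memLp_two : ∀ a t, MemLp (X a t) 2 μ
  mean_zero : ∀ a t, ∫ ω, X a t ω ∂μ = 0
  stationary : ∀ a₁ a₂ τ t s,
    ∫ ω, X a₁ (t + τ) ω * X a₂ t ω ∂μ = ∫ ω, X a₁ (s + τ) ω * X a₂ s ω ∂μ
  continuous : ∀ a t, Tendsto (fun s => ∫ ω, (X a s ω - X a t ω) ^ 2 ∂μ) (𝓝 t) (𝓝 0)

/-- The covariance `C_{a₁a₂}(τ) = E[X_{a₁}(t+τ) X_{a₂}(t)]`, evaluated at `t = 0`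
(for a stationary process the choice of `t` does not matter). -/
def crossCov {Ω : Type*} [MeasurableSpace Ω] (μ : Measure Ω)
    {r : ℕ} (X : Fin r → ℝ → Ω → ℝ) (a₁ a₂ : Fin r) (τ : ℝ) : ℝ :=
  ∫ ω, X a₁ (0 + τ) ω * X a₂ 0 ω ∂μ

/-- The envelope `g_{a₁a₂}(t) = sup_{|s| ≥ |t|} |C_{a₁a₂}(s)|`. (For a second order stationary
process the supremum is over a nonempty bounded set.) -/
def covEnvelope {Ω : Type*} [MeasurableSpace Ω] (μ : Measure Ω)
    {r : ℕ} (X : Fin r → ℝ → Ω → ℝ) (a₁ a₂ : Fin r) (t : ℝ) : ℝ :=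
  sSup {c : ℝ | ∃ s : ℝ, |t| ≤ |s| ∧ c = |crossCov μ X a₁ a₂ s|}

/-- All covariance envelopes are integrable over the real line. -/
def HasIntegrableCovEnvelopes {Ω : Type*} [MeasurableSpace Ω] (μ : Measure Ω)
    {r : ℕ} (X : Fin r → ℝ → Ω → ℝ) : Prop :=
  ∀ a₁ a₂ : Fin r, Integrable (covEnvelope μ X a₁ a₂) volume

/-- Covariance averaging kernel: continuous, even, square integrable, `K(0) = 1`, and bounded by
a nonnegative, even, integrable, unimodal function `K₁` with its unique maximum at `0`. -/
structure IsCovAveragingKernel (K : ℝ → ℝ) : Prop where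
  continuous : Continuous K
  even : ∀ x, K (-x) = K x
  sq_integrable : Integrable (fun x => K x ^ 2) volume
  zero : K 0 = 1
  bound : ∃ K₁ : ℝ → ℝ, (∀ x, 0 ≤ K₁ x) ∧ (∀ x, K₁ (-x) = K₁ x) ∧ Integrable K₁ volume ∧
    (∀ x, x ≠ 0 → K₁ x < K₁ 0) ∧ AntitoneOn K₁ (Set.Ici 0) ∧ ∀ x, |K x| ≤ K₁ x

/-- Strict stationarity: all finite dimensional distributions of the vector process are
invariant under time shifts. -/
def IsStrictlyStationary {Ω : Type*} [MeasurableSpace Ω] (μ : Measure Ω)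
    {r : ℕ} (X : Fin r → ℝ → Ω → ℝ) : Prop :=
  ∀ (m : ℕ) (t : Fin m → ℝ) (h : ℝ),
    IdentDistrib (fun ω (j : Fin m) (a : Fin r) => X a (t j + h) ω)
      (fun ω (j : Fin m) (a : Fin r) => X a (t j) ω) μ μ

/-- Strict stationarity, existence of all moments, and domination of all joint cumulants of order
`k = m + 1 > 2` by products of continuous, even, nonnegative, integrable functions that are
non-increasing on `(0, ∞)`. The times are `t₁ + t, …, t_m + t, t`. -/
structure HasDominatedCumulants {Ω : Type*} [MeasurableSpace Ω] (μ : Measure Ω)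
    {r : ℕ} (X : Fin r → ℝ → Ω → ℝ) : Prop where
  strictlyStationary : IsStrictlyStationary μ X
  moments : ∀ k : ℕ, 2 < k → ∀ a t, Integrable (fun ω => X a t ω ^ k) μ
  cumulants : ∀ m : ℕ, 2 < m + 1 → ∀ a : Fin (m + 1) → Fin r,
    ∃ g : Fin m → ℝ → ℝ,
      (∀ i, Continuous (g i) ∧ (∀ x, g i (-x) = g i x) ∧ (∀ x, 0 ≤ g i x) ∧
        Integrable (g i) volume ∧ AntitoneOn (g i) (Set.Ioi 0)) ∧
      ∀ (τ : Fin m → ℝ) (t : ℝ),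
        |jointCumulant μ (fun j : Fin (m + 1) =>
            X (a j) ((Fin.snoc τ 0 : Fin (m + 1) → ℝ) j + t))| ≤ ∏ i, g i (τ i)

/-- The estimator `φ̂_{a₁a₂}(ν)` of the (cross-)spectral density at the frequency `ν`, from `n`
samples taken at rate `ρ`, with kernel `K` and bandwidth `b`. -/
def specEstimator {Ω : Type*} {r : ℕ} (X : Fin r → ℝ → Ω → ℝ) (K : ℝ → ℝ)
    (n : ℕ) (b ρ : ℝ) (a₁ a₂ : Fin r) (ν : ℝ) (ω : Ω) : ℂ :=
  (1 / (2 * (Real.pi : ℂ) * (n : ℂ) * (ρ : ℂ))) *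
    ∑ t₁ ∈ Finset.Icc 1 n, ∑ t₂ ∈ Finset.Icc 1 n,
      (K (b * ((t₁ : ℝ) - (t₂ : ℝ))) : ℂ) *
        (X a₁ ((t₁ : ℝ) / ρ) ω : ℂ) * (X a₂ ((t₂ : ℝ) / ρ) ω : ℂ) *
        Complex.exp (-(Complex.I * ((t₁ : ℂ) - (t₂ : ℂ)) * (ν : ℂ) / (ρ : ℂ))) *
        Set.indicator (Set.Icc (-(Real.pi * ρ)) (Real.pi * ρ)) (fun _ => (1 : ℂ)) ν

end

/-! Expanding the estimators by multilinearity bounds the cumulant by `(2πnρ)^(-L)` times a sum over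
the `2L` sampling times. The summand is the absolute cumulant of the `L` products `X X`, times
`K₁(b(t₁ - t₂))` for each pair (`norm_jointCumulant_specEstimator_le`). Instead of expanding
cumulants of products over indecomposable partitions, one pair is opened at a time by `cum(XY, S) =
cum(X, Y, S) + ∑_A cum(X, A) cum(Y, S \ A)` (`setCumulant_insert_of_moment_eq`,
`mixedCumulant_split`). This turns the connectivity argument into an induction on the number of
unopened pairs.

The rest is power counting. In a cumulant of single variables, with one time fixed, summing out each
other time costs `ρ`, since the dominating functions are sampled at spacing `1/ρ`. If the two
variables of a pair land in different cumulants, the kernel links them, and summing it costs `1/b =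
ρ (ρb)⁻¹`. So a family of `N` variables costs `ρ^(N-1)` and one `(ρb)⁻¹` per linking kernel. With
`L` linking kernels the `L + 1` cumulants would form a tree, whose leaves are cumulants of a single
variable and vanish because the mean is zero; hence at most `L - 1` kernels link
(`hasSumBound_kernelWeight`).

The free time contributes `n`, and `n (nρ)^(-L) ρ^(2L-1) (ρb)^(-(L-1)) = (nb)^(-(L-1))`. The
constant is uniform in `n` because `ρ_n` is bounded below by a positive number and `ρ_n b_n` is
bounded above. -/

noncomputable section

/-! ### Combinatorics of cumulants of set functions. -/

section SetCumulant

variable {ι R : Type*} [DecidableEq ι] [CommRing R]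

/-- The cumulant of the index set `S` associated with a moment function `M` on finite sets. -/
def setCumulant (M : Finset ι → R) (S : Finset ι) : R :=
  ∑ π : Finpartition S, (-1 : R) ^ (π.parts.card - 1) *
    (Nat.factorial (π.parts.card - 1) : R) * ∏ B ∈ π.parts, M B

/-- The collections of blocks of all partitions of `S`. -/
def blockFamilies (S : Finset ι) : Finset (Finset (Finset ι)) :=
  Finset.univ.map ⟨Finpartition.parts (a := S), fun _ _ h => Finpartition.ext h⟩

theorem mem_blockFamilies {S : Finset ι} {P : Finset (Finset ι)} :
    P ∈ blockFamilies S ↔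
      ∅ ∉ P ∧ (∀ A ∈ P, ∀ B ∈ P, A ≠ B → Disjoint A B) ∧ P.sup id = S := by
  simp only [blockFamilies, Finset.mem_map, Finset.mem_univ, true_and]
  constructor
  · rintro ⟨π, rfl⟩
    exact ⟨π.bot_notMem, fun A hA B hB h => π.disjoint hA hB h, π.sup_parts⟩
  · rintro ⟨h0, h1, h2⟩
    refine ⟨⟨P, ?_, h2, h0⟩, rfl⟩
    rw [Finset.supIndep_iff_pairwiseDisjoint]
    intro A hA B hB h
    exact h1 A hA B hB h

theorem setCumulant_eq_sum_blockFamilies (M : Finset ι → R) (S : Finset ι) :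
    setCumulant M S = ∑ P ∈ blockFamilies S, (-1 : R) ^ (P.card - 1) *
      (Nat.factorial (P.card - 1) : R) * ∏ B ∈ P, M B := by
  simp only [setCumulant, blockFamilies, Finset.sum_map]
  rfl

theorem card_filter_notMem_blockFamilies {S : Finset ι} {P : Finset (Finset ι)}
    (hP : P ∈ blockFamilies S) {x : ι} (hx : x ∈ S) :
    (P.filter (fun C => x ∉ C)).card = P.card - 1 := by
  obtain ⟨-, h1, h2⟩ := mem_blockFamilies.1 hP
  rw [← h2, Finset.mem_sup] at hx
  obtain ⟨B, hB, hxB⟩ := hx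
  have : P.filter (fun C => x ∉ C) = P.erase B := by
    ext C
    simp only [Finset.mem_filter, Finset.mem_erase]
    constructor
    · rintro ⟨hC, hxC⟩
      exact ⟨fun h => hxC (h ▸ hxB), hC⟩
    · rintro ⟨hCB, hC⟩
      exact ⟨hC, fun hxC => Finset.disjoint_left.1 (h1 C hC B hB hCB) hxC hxB⟩
  rw [this, Finset.card_erase_of_mem hB]

theorem blockFamilies_card_eq_one_iff {S : Finset ι} {P : Finset (Finset ι)}
    (hP : P ∈ blockFamilies S) : P.card = 1 ↔ P = {S} := by
  constructor
  · intro h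
    obtain ⟨B, rfl⟩ := Finset.card_eq_one.1 h
    have := (mem_blockFamilies.1 hP).2.2
    simpa using this
  · rintro rfl
    simp

/-- Adding the block `S \ B` to a partition of `B`, and removing a block that misses `x`, are
mutually inverse. The conjunct `x ∈ S` makes the right side empty, like the left, when `x ∉ S`. -/
theorem sum_ssubset_blockFamilies {N : Type*} [AddCommMonoid N] (S : Finset ι) {x : ι}
    (F : Finset (Finset ι) → Finset ι → N) :
    ∑ B ∈ S.powerset.filter (fun B => x ∈ B ∧ B ≠ S), ∑ P ∈ blockFamilies B,
        F (insert (S \ B) P) (S \ B) =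
      ∑ P ∈ blockFamilies S, ∑ C ∈ P.filter (fun C => x ∉ C ∧ x ∈ S), F P C := by
  rw [Finset.sum_sigma', Finset.sum_sigma']
  refine Finset.sum_nbij' (fun p => ⟨insert (S \ p.1) p.2, S \ p.1⟩)
    (fun p => ⟨S \ p.2, p.1.erase p.2⟩) ?_ ?_ ?_ ?_ ?_
  · rintro ⟨B, P⟩ h
    simp only [Finset.mem_sigma, Finset.mem_filter, Finset.mem_powerset, mem_blockFamilies] at h ⊢
    obtain ⟨⟨hBS, hxB, hne⟩, h0, h1, h2⟩ := h
    have hsub : ∀ A ∈ P, A ⊆ B := fun A hA => h2 ▸ Finset.le_sup (f := id) hA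
    have hd : ∀ A ∈ P, Disjoint (S \ B) A := fun A hA =>
      Finset.sdiff_disjoint.mono_right (hsub A hA)
    refine ⟨⟨?_, ?_, ?_⟩, Finset.mem_insert_self _ _, ?_, hBS hxB⟩
    · rw [Finset.mem_insert, not_or]
      refine ⟨fun h => hne ?_, h0⟩
      exact hBS.antisymm (Finset.sdiff_eq_empty_iff_subset.1 h.symm)
    · intro A hA C hC hAC
      rw [Finset.mem_insert] at hA hC
      rcases hA with rfl | hA <;> rcases hC with rfl | hC
      · exact absurd rfl hAC
      · exact hd _ hC
      · exact (hd _ hA).symm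
      · exact h1 _ hA _ hC hAC
    · rw [Finset.sup_insert, h2]
      exact Finset.sdiff_union_of_subset hBS
    · simp [hxB]
  · rintro ⟨P, C⟩ h
    simp only [Finset.mem_sigma, Finset.mem_filter, Finset.mem_powerset, mem_blockFamilies] at h ⊢
    obtain ⟨⟨h0, h1, h2⟩, hC, hxC, hxS⟩ := h
    have hCS : C ⊆ S := h2 ▸ Finset.le_sup (f := id) hC
    refine ⟨⟨Finset.sdiff_subset, by simp [hxC, hxS], ?_⟩, ?_, ?_, ?_⟩
    · intro h
      rw [Finset.sdiff_eq_self_iff_disjoint] at h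
      have : C = ∅ := by
        rw [← Finset.disjoint_self_iff_empty]; exact h.mono_left hCS
      exact h0 (this ▸ hC)
    · exact fun h => h0 (Finset.mem_of_mem_erase h)
    · exact fun A hA B hB => h1 A (Finset.mem_of_mem_erase hA) B (Finset.mem_of_mem_erase hB)
    · have hd : Disjoint C ((P.erase C).sup id) := by
        rw [Finset.disjoint_sup_right]
        intro A hA
        exact h1 C hC A (Finset.mem_of_mem_erase hA) (Finset.ne_of_mem_erase hA).symm
      have : S = C ∪ (P.erase C).sup id := by
        rw [← h2]
        conv_lhs => rw [← Finset.insert_erase hC]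
        rw [Finset.sup_insert]; rfl
      rw [this, Finset.union_sdiff_cancel_left hd]
  · rintro ⟨B, P⟩ h
    simp only [Finset.mem_sigma, Finset.mem_filter, Finset.mem_powerset, mem_blockFamilies] at h ⊢
    obtain ⟨⟨hBS, hxB, hne⟩, h0, h1, h2⟩ := h
    have hn : S \ B ∉ P := by
      intro h
      have h3 : S \ B ⊆ B := (Finset.le_sup (f := id) h).trans h2.le
      have : S \ B = ∅ := by
        rw [← Finset.disjoint_self_iff_empty]
        exact Finset.sdiff_disjoint.mono_right h3
      exact h0 (this ▸ h)
    rw [Finset.sdiff_sdiff_eq_self hBS, Finset.erase_insert hn]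
  · rintro ⟨P, C⟩ h
    simp only [Finset.mem_sigma, Finset.mem_filter, mem_blockFamilies] at h ⊢
    obtain ⟨⟨h0, h1, h2⟩, hC, hxC, hxS⟩ := h
    have hCS : C ⊆ S := h2 ▸ Finset.le_sup (f := id) hC
    rw [Finset.sdiff_sdiff_eq_self hCS, Finset.insert_erase hC]
  · rintro ⟨B, P⟩ h
    rfl

/-- A partition of `S` into `p` blocks arises `p - 1` times from the terms `B ≠ S`, once for each
block without `x`. Its total coefficient there, `(p-1) (-1)^(p-2) (p-2)!`, cancels its coefficient
in the term `B = S` unless `p = 1`, which leaves `M S`. -/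
theorem setCumulant_recursion_of_mem (M : Finset ι → R) (hM : M ∅ = 1) {S : Finset ι} {x : ι}
    (hx : x ∈ S) :
    ∑ B ∈ S.powerset.filter (fun B => x ∈ B), setCumulant M B * M (S \ B) = M S := by
  have hS : S ∈ S.powerset.filter (fun B => x ∈ B) := by simp [hx]
  have key : ∑ B ∈ S.powerset.filter (fun B => x ∈ B ∧ B ≠ S), setCumulant M B * M (S \ B) =
      ∑ P ∈ blockFamilies S, ((P.card - 1 : ℕ) : R) * ((-1 : R) ^ (P.card - 1 - 1) *
        (Nat.factorial (P.card - 1 - 1) : R) * ∏ B ∈ P, M B) := by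
    have h := sum_ssubset_blockFamilies (x := x) S (fun P _ => (-1 : R) ^ (P.card - 1 - 1) *
        (Nat.factorial (P.card - 1 - 1) : R) * ∏ B ∈ P, M B)
    have h' : ∀ P ∈ blockFamilies S,
        ∑ C ∈ P.filter (fun C => x ∉ C ∧ x ∈ S), ((-1 : R) ^ (P.card - 1 - 1) *
          (Nat.factorial (P.card - 1 - 1) : R) * ∏ B ∈ P, M B) =
        ((P.card - 1 : ℕ) : R) * ((-1 : R) ^ (P.card - 1 - 1) *
        (Nat.factorial (P.card - 1 - 1) : R) * ∏ B ∈ P, M B) := by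
      intro P hP
      rw [Finset.sum_const, nsmul_eq_mul]
      simp only [hx, and_true]
      rw [card_filter_notMem_blockFamilies hP hx]
    rw [Finset.sum_congr rfl h'] at h
    rw [← h]
    refine Finset.sum_congr rfl fun B hB => ?_
    rw [setCumulant_eq_sum_blockFamilies, Finset.sum_mul]
    refine Finset.sum_congr rfl fun P hP => ?_
    simp only [Finset.mem_filter, Finset.mem_powerset] at hB
    have hn : S \ B ∉ P := by
      obtain ⟨h0, h1, h2⟩ := mem_blockFamilies.1 hP
      intro h
      have h3 : S \ B ⊆ B := (Finset.le_sup (f := id) h).trans h2.le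
      have : S \ B = ∅ := by
        rw [← Finset.disjoint_self_iff_empty]
        exact Finset.sdiff_disjoint.mono_right h3
      exact h0 (this ▸ h)
    rw [Finset.card_insert_of_notMem hn, Finset.prod_insert hn, Nat.add_sub_cancel]
    ring
  rw [← Finset.add_sum_erase _ _ hS, Finset.sdiff_self, hM, mul_one]
  have he : (S.powerset.filter (fun B => x ∈ B)).erase S =
      S.powerset.filter (fun B => x ∈ B ∧ B ≠ S) := by
    ext B
    simp only [Finset.mem_erase, Finset.mem_filter]
    tauto
  rw [he, key, setCumulant_eq_sum_blockFamilies, ← Finset.sum_add_distrib]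
  have hS' : {S} ∈ blockFamilies S := by
    rw [mem_blockFamilies]
    refine ⟨?_, ?_, by simp⟩
    · simpa using (Finset.ne_empty_of_mem hx).symm
    · intro A hA B hB h
      simp only [Finset.mem_singleton] at hA hB
      exact absurd (hA.trans hB.symm) h
  rw [Finset.sum_eq_single_of_mem _ hS']
  · simp
  · intro P hP hne
    have h1 : P.card ≠ 1 := fun h => hne ((blockFamilies_card_eq_one_iff hP).1 h)
    have h0 : P.card ≠ 0 := by
      rw [Finset.card_ne_zero]
      by_contra h
      rw [Finset.not_nonempty_iff_eq_empty] at h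
      have := (mem_blockFamilies.1 hP).2.2
      rw [h] at this
      simp only [Finset.sup_empty, Finset.bot_eq_empty] at this
      rw [← this] at hx
      simp at hx
    obtain ⟨k, hk⟩ : ∃ k, P.card = k + 2 := ⟨P.card - 2, by omega⟩
    rw [hk]
    simp only [Nat.add_sub_cancel, show k + 2 - 1 = k + 1 by omega, pow_succ,
      Nat.factorial_succ]
    push_cast
    ring

theorem setCumulant_recursion (M : Finset ι → R) (hM : M ∅ = 1) {S : Finset ι} {x : ι}
    (hx : x ∉ S) :
    ∑ A ∈ S.powerset, setCumulant M (insert x A) * M (S \ A) = M (insert x S) := by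
  rw [← setCumulant_recursion_of_mem M hM (Finset.mem_insert_self x S)]
  refine Finset.sum_nbij' (fun A => insert x A) (fun B => B.erase x) ?_ ?_ ?_ ?_ ?_
  · intro A hA
    simp only [Finset.mem_filter, Finset.mem_powerset, Finset.mem_insert_self, and_true] at *
    exact Finset.insert_subset_insert _ hA
  · intro B hB
    simp only [Finset.mem_filter, Finset.mem_powerset] at *
    exact Finset.subset_insert_iff.1 hB.1
  · intro A hA
    simp only [Finset.mem_powerset] at *
    exact Finset.erase_insert fun h => hx (hA h)
  · intro B hB
    simp only [Finset.mem_filter, Finset.mem_powerset] at *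
    exact Finset.insert_erase hB.2
  · intro A hA
    simp only [Finset.mem_powerset] at *
    congr 2
    ext y
    simp only [Finset.mem_sdiff, Finset.mem_insert]
    constructor
    · rintro ⟨h1, h2⟩
      refine ⟨Or.inr h1, ?_⟩
      rintro (rfl | h)
      · exact hx h1
      · exact h2 h
    · tauto

theorem setCumulant_singleton (M : Finset ι → R) (hM : M ∅ = 1) (x : ι) :
    setCumulant M {x} = M {x} := by
  have := setCumulant_recursion M hM (Finset.notMem_empty x)
  simpa [hM] using this

theorem setCumulant_pair (M : Finset ι → R) (hM : M ∅ = 1) {x y : ι} (hxy : x ≠ y) :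
    setCumulant M {x, y} = M {x, y} - M {x} * M {y} := by
  have h := setCumulant_recursion M hM (S := {y}) (x := x) (by simpa using hxy)
  rw [show ({y} : Finset ι).powerset = {∅, {y}} from rfl,
    Finset.sum_pair (Finset.singleton_ne_empty y).symm] at h
  simp only [insert_empty_eq, Finset.sdiff_empty, Finset.sdiff_self, hM, mul_one,
    setCumulant_singleton M hM] at h
  rw [← h]; ring

/-- A set function is determined by its convolution with a moment function. -/
theorem eq_of_sum_powerset_mul_eq (M : Finset ι → R) (hM : M ∅ = 1) (f g : Finset ι → R)
    (S : Finset ι)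
    (h : ∀ S' ⊆ S, ∑ A ∈ S'.powerset, f A * M (S' \ A) = ∑ A ∈ S'.powerset, g A * M (S' \ A)) :
    f S = g S := by
  induction S using Finset.strongInduction with
  | H S ih =>
    -- The system is triangular with unit diagonal: the term `A = S` carries the weight `M ∅ = 1`.
    have h1 := h S subset_rfl
    rw [← Finset.add_sum_erase _ _ (Finset.mem_powerset_self S),
      ← Finset.add_sum_erase _ (fun A => g A * M (S \ A)) (Finset.mem_powerset_self S)] at h1
    have h2 : ∀ A ∈ S.powerset.erase S, f A * M (S \ A) = g A * M (S \ A) := by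
      intro A hA
      simp only [Finset.mem_erase, Finset.mem_powerset] at hA
      rw [ih A (Finset.ssubset_iff_subset_ne.2 ⟨hA.2, hA.1⟩)
        fun S' hS' => h S' (hS'.trans hA.2)]
    rw [Finset.sum_congr rfl h2] at h1
    simpa only [Finset.sdiff_self, hM, mul_one] using add_right_cancel h1

theorem sum_powerset_sum_powerset_sdiff {N : Type*} [AddCommMonoid N] (S : Finset ι)
    (F : Finset ι → Finset ι → N) :
    ∑ A ∈ S.powerset, ∑ C ∈ (S \ A).powerset, F A C =
      ∑ D ∈ S.powerset, ∑ A ∈ D.powerset, F A (D \ A) := by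
  rw [Finset.sum_sigma', Finset.sum_sigma']
  refine Finset.sum_nbij' (fun p => ⟨p.1 ∪ p.2, p.1⟩) (fun p => ⟨p.2, p.1 \ p.2⟩) ?_ ?_ ?_ ?_ ?_
  · rintro ⟨A, C⟩ h
    simp only [Finset.mem_sigma, Finset.mem_powerset] at *
    exact ⟨Finset.union_subset h.1 (h.2.trans Finset.sdiff_subset), Finset.subset_union_left⟩
  · rintro ⟨D, A⟩ h
    simp only [Finset.mem_sigma, Finset.mem_powerset] at *
    exact ⟨h.2.trans h.1, Finset.sdiff_subset_sdiff h.1 subset_rfl⟩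
  · rintro ⟨A, C⟩ h
    simp only [Finset.mem_sigma, Finset.mem_powerset] at *
    rw [Finset.union_sdiff_cancel_left (Finset.disjoint_sdiff.mono_right h.2)]
  · rintro ⟨D, A⟩ h
    simp only [Finset.mem_sigma, Finset.mem_powerset] at *
    rw [Finset.union_sdiff_of_subset h.2]
  · rintro ⟨A, C⟩ h
    simp only [Finset.mem_sigma, Finset.mem_powerset] at *
    rw [Finset.union_sdiff_cancel_left (Finset.disjoint_sdiff.mono_right h.2)]

/-- The cumulant of a family one of whose members is a product of two variables. -/
theorem setCumulant_insert_of_moment_eq (M : Finset ι → R) (hM : M ∅ = 1) {S : Finset ι}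
    {x y z : ι} (hx : x ∉ S) (hy : y ∉ S) (hz : z ∉ S) (hxy : x ≠ y)
    (h : ∀ S' ⊆ S, M (insert z S') = M (insert x (insert y S'))) :
    setCumulant M (insert z S) = setCumulant M (insert x (insert y S)) +
      ∑ A ∈ S.powerset, setCumulant M (insert x A) * setCumulant M (insert y (S \ A)) := by
  refine eq_of_sum_powerset_mul_eq M hM (fun S => setCumulant M (insert z S))
    (fun S => setCumulant M (insert x (insert y S)) +
      ∑ A ∈ S.powerset, setCumulant M (insert x A) * setCumulant M (insert y (S \ A))) S ?_
  intro T hT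
  have hxT : x ∉ insert y T := by
    simp only [Finset.mem_insert, not_or]; exact ⟨hxy, fun h => hx (hT h)⟩
  have hyT : y ∉ T := fun h => hy (hT h)
  -- The left side collapses to the moment of `x`, `y` and `T`. Expanding that moment at `x`, the
  -- terms whose cumulant also contains `y` match the first summand on the right.
  rw [setCumulant_recursion M hM fun h => hz (hT h), h T hT, ← setCumulant_recursion M hM hxT,
    Finset.sum_powerset_insert hyT]
  simp only [add_mul, Finset.sum_add_distrib]
  rw [add_comm]
  congr 1
  · refine Finset.sum_congr rfl fun A hA => ?_
    rw [Finset.mem_powerset] at hA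
    congr 2
    ext w
    simp only [Finset.mem_sdiff, Finset.mem_insert]
    constructor
    · tauto
    · rintro ⟨h1, h2⟩
      refine ⟨Or.inr h1, ?_⟩
      rintro (rfl | h)
      · exact hyT h1
      · exact h2 h
  -- In the other terms `y` is left in the moment factor, which a second recursion, at `y`, expands.
  · have h1 : ∀ A ∈ T.powerset, setCumulant M (insert x A) * M (insert y T \ A) =
        ∑ C ∈ (T \ A).powerset, setCumulant M (insert x A) *
          setCumulant M (insert y C) * M (T \ (A ∪ C)) := by
      intro A hA
      rw [Finset.mem_powerset] at hA
      rw [Finset.insert_sdiff_of_notMem _ fun h => hyT (hA h),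
        ← setCumulant_recursion M hM (S := T \ A) (x := y) (by simp [hyT]), Finset.mul_sum]
      refine Finset.sum_congr rfl fun C _ => ?_
      rw [sdiff_sdiff_left, mul_assoc]; rfl
    rw [Finset.sum_congr rfl h1, sum_powerset_sum_powerset_sdiff]
    refine Finset.sum_congr rfl fun D _ => ?_
    rw [Finset.sum_mul]
    refine Finset.sum_congr rfl fun A hA => ?_
    rw [Finset.mem_powerset] at hA
    rw [Finset.union_sdiff_of_subset hA]

/-- The recursion at a fixed element determines the cumulants of the sets containing it, and both
sides satisfy it; partitions need not be transported. -/
theorem setCumulant_map {κ : Type*} [DecidableEq κ] (e : κ ↪ ι) (M : Finset ι → R)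
    (hM : M ∅ = 1) {S : Finset κ} (hS : S.Nonempty) :
    setCumulant M (S.map e) = setCumulant (fun T : Finset κ => M (T.map e)) S := by
  obtain ⟨x, hx⟩ := hS
  have h := eq_of_sum_powerset_mul_eq (fun T : Finset κ => M (T.map e)) (by simpa using hM)
    (fun T => setCumulant M ((insert x T).map e))
    (fun T => setCumulant (fun T : Finset κ => M (T.map e)) (insert x T)) (S.erase x) ?_
  · simpa [Finset.insert_erase hx] using h
  intro T hT
  have hxT : x ∉ T := fun h => Finset.notMem_erase x S (hT h)
  rw [setCumulant_recursion (fun T : Finset κ => M (T.map e)) (by simpa using hM) hxT]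
  simp only [Finset.map_insert]
  rw [← setCumulant_recursion M hM (S := T.map e) (x := e x) (by simpa using hxT)]
  have hp : (T.map e).powerset = T.powerset.map (Finset.mapEmbedding e).toEmbedding := by
    ext A
    simp only [Finset.mem_powerset, Finset.mem_map, Finset.subset_map_iff,
      RelEmbedding.coe_toEmbedding, Finset.mapEmbedding_apply]
    constructor
    · rintro ⟨B, h1, h2⟩; exact ⟨B, h1, h2.symm⟩
    · rintro ⟨B, h1, h2⟩; exact ⟨B, h1, h2.symm⟩
  rw [hp, Finset.sum_map]
  refine Finset.sum_congr rfl fun A _ => ?_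
  simp only [RelEmbedding.coe_toEmbedding, Finset.mapEmbedding_apply]
  rw [← Finset.map_sdiff]

end SetCumulant

/-! ### Moments of all orders and multilinearity of the joint cumulant. -/

section Moments

variable {Ω : Type*} [MeasurableSpace Ω] {μ : Measure Ω} {𝕜 : Type*} [RCLike 𝕜]

/-- The moments of the subfamilies of a family of random variables. -/
def jointMoment (μ : Measure Ω) {ι : Type*} (Y : ι → Ω → 𝕜) (S : Finset ι) : 𝕜 :=
  ∫ ω, ∏ j ∈ S, Y j ω ∂μ

theorem jointMoment_empty [IsProbabilityMeasure μ] {ι : Type*} (Y : ι → Ω → 𝕜) :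
    jointMoment μ Y ∅ = 1 := by
  simp [jointMoment]

theorem jointCumulant_eq_setCumulant {k : ℕ} (Y : Fin k → Ω → 𝕜) :
    jointCumulant μ Y = setCumulant (jointMoment μ Y) Finset.univ := rfl

theorem jointCumulant_eq_setCumulant_map [IsProbabilityMeasure μ] {ι : Type*} [DecidableEq ι]
    (Y : ι → Ω → 𝕜) {k : ℕ} [NeZero k] (e : Fin k ↪ ι) :
    jointCumulant μ (fun j => Y (e j)) =
      setCumulant (jointMoment μ Y) (Finset.univ.map e) := by
  rw [setCumulant_map e _ (jointMoment_empty Y) ⟨0, Finset.mem_univ _⟩,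
    jointCumulant_eq_setCumulant]
  congr 1
  ext T
  simp [jointMoment, Finset.prod_map]

theorem jointCumulant_ofReal {k : ℕ} (Y : Fin k → Ω → ℝ) :
    jointCumulant μ (fun j ω => (Y j ω : ℂ)) = ((jointCumulant μ Y : ℝ) : ℂ) := by
  simp only [jointCumulant]
  push_cast
  refine Finset.sum_congr rfl fun π _ => ?_
  congr 1
  refine Finset.prod_congr rfl fun B _ => ?_
  rw [← integral_complex_ofReal]
  push_cast
  rfl

/-- The random variables that have finite absolute moments of all orders. -/
def allMoments (μ : Measure Ω) (𝕜 : Type*) [RCLike 𝕜] : Submodule 𝕜 (Ω → 𝕜) where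
  carrier := {f | ∀ p : ENNReal, p ≠ ⊤ → MemLp f p μ}
  add_mem' hf hg p hp := (hf p hp).add (hg p hp)
  zero_mem' _ _ := MemLp.zero
  smul_mem' c _ hf p hp := (hf p hp).const_smul c

theorem mul_mem_allMoments {f g : Ω → 𝕜} (hf : f ∈ allMoments μ 𝕜) (hg : g ∈ allMoments μ 𝕜) :
    f * g ∈ allMoments μ 𝕜 := by
  intro p hp
  have h2 : 2 * p ≠ ⊤ := ENNReal.mul_ne_top (by simp) hp
  have : ENNReal.HolderTriple (2 * p) (2 * p) p := ⟨by
    rw [ENNReal.mul_inv (by simp) (by simp), ← add_mul, ENNReal.inv_two_add_inv_two, one_mul]⟩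
  exact (hg _ h2).mul (hf _ h2)

theorem prod_mem_allMoments [IsProbabilityMeasure μ] {ι : Type*} {Y : ι → Ω → 𝕜}
    (S : Finset ι) (hY : ∀ i ∈ S, Y i ∈ allMoments μ 𝕜) :
    (fun ω => ∏ i ∈ S, Y i ω) ∈ allMoments μ 𝕜 := by
  classical
  induction S using Finset.induction_on with
  | empty => intro p _; simpa using memLp_const (1 : 𝕜)
  | insert i S hi ih =>
    simp only [Finset.prod_insert hi]
    exact mul_mem_allMoments (hY i (Finset.mem_insert_self _ _))
      (ih fun j hj => hY j (Finset.mem_insert_of_mem hj))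

theorem integrable_of_mem_allMoments {f : Ω → 𝕜} (hf : f ∈ allMoments μ 𝕜) : Integrable f μ :=
  memLp_one_iff_integrable.1 (hf 1 (by simp))

theorem ofReal_mem_allMoments {f : Ω → ℝ} (hf : f ∈ allMoments μ ℝ) :
    (fun ω => (f ω : ℂ)) ∈ allMoments μ ℂ := fun p hp => (hf p hp).ofReal

theorem mem_allMoments_of_integrable_pow [IsProbabilityMeasure μ] {f : Ω → ℝ}
    (hf : Measurable f) (h : ∀ k : ℕ, 2 < k → Integrable (fun ω => f ω ^ k) μ) :
    f ∈ allMoments μ ℝ := by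
  intro p hp
  obtain ⟨m, hm⟩ := ENNReal.exists_nat_gt hp
  -- The shift by 3 brings the exponent into the range `k > 2` of the hypothesis.
  have hlp : MemLp f ((m + 3 : ℕ) : ENNReal) μ := by
    rw [← integrable_norm_rpow_iff hf.aestronglyMeasurable (by simp) (by simp)]
    have := (h (m + 3) (by omega)).norm
    simpa only [norm_pow, ENNReal.toReal_natCast, Real.rpow_natCast] using this
  refine hlp.mono_exponent (hm.le.trans ?_)
  exact_mod_cast (by omega : m ≤ m + 3)

/-- Exactly one block contains `i`, so each term of the cumulant depends on the `i`-th variable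
through a single integral, linearly. -/
theorem prod_parts_jointMoment_update {k : ℕ} (π : Finpartition (Finset.univ : Finset (Fin k)))
    (Y : Fin k → Ω → 𝕜) (i : Fin k) (v : Ω → 𝕜) :
    ∏ B ∈ π.parts, ∫ ω, ∏ j ∈ B, Function.update Y i v j ω ∂μ =
      (∏ B ∈ π.parts.erase (π.part i), ∫ ω, ∏ j ∈ B, Y j ω ∂μ) *
        ∫ ω, v ω * ∏ j ∈ (π.part i).erase i, Y j ω ∂μ := by
  have hmem : π.part i ∈ π.parts := π.part_mem.2 (Finset.mem_univ i)
  rw [← Finset.prod_erase_mul _ _ hmem]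
  congr 1
  · refine Finset.prod_congr rfl fun B hB => ?_
    rw [Finset.mem_erase] at hB
    have hi : i ∉ B := fun hi => hB.1 (π.part_eq_of_mem hB.2 hi).symm
    refine integral_congr_ae (Eventually.of_forall fun ω => ?_)
    refine Finset.prod_congr rfl fun j hj => ?_
    rw [Function.update_of_ne (ne_of_mem_of_not_mem hj hi)]
  · refine integral_congr_ae (Eventually.of_forall fun ω => ?_)
    have hi : i ∈ π.part i := π.mem_part (Finset.mem_univ i)
    simp only
    rw [← Finset.mul_prod_erase _ _ hi, Function.update_self]
    congr 1
    refine Finset.prod_congr rfl fun j hj => ?_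
    rw [Function.update_of_ne (Finset.ne_of_mem_erase hj)]

theorem jointCumulant_update {k : ℕ} (Y : Fin k → Ω → 𝕜) (i : Fin k) (v : Ω → 𝕜) :
    jointCumulant μ (Function.update Y i v) =
      ∑ π : Finpartition (Finset.univ : Finset (Fin k)),
        (-1 : 𝕜) ^ (π.parts.card - 1) * (Nat.factorial (π.parts.card - 1) : 𝕜) *
          ((∏ B ∈ π.parts.erase (π.part i), ∫ ω, ∏ j ∈ B, Y j ω ∂μ) *
            ∫ ω, v ω * ∏ j ∈ (π.part i).erase i, Y j ω ∂μ) := by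
  refine Finset.sum_congr rfl fun π _ => ?_
  rw [prod_parts_jointMoment_update]

theorem coe_update_allMoments {k : ℕ} (Y : Fin k → allMoments μ 𝕜) (i : Fin k)
    (w : allMoments μ 𝕜) : (fun j => ((Function.update Y i w) j : Ω → 𝕜)) =
      Function.update (fun j => (Y j : Ω → 𝕜)) i w := by
  ext j ω
  by_cases h : j = i
  · subst h; simp
  · simp [h]

/-- The joint cumulant as a multilinear map on the variables with moments of all orders. -/
def jointCumulantMultilinear (μ : Measure Ω) [IsProbabilityMeasure μ] (𝕜 : Type*) [RCLike 𝕜]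
    (k : ℕ) : MultilinearMap 𝕜 (fun _ : Fin k => allMoments μ 𝕜) 𝕜 where
  toFun Y := jointCumulant μ (fun j => (Y j : Ω → 𝕜))
  map_update_add' {dec} Y i u v := by
    have hdec : dec = instDecidableEqFin k := Subsingleton.elim _ _
    subst hdec
    have hint : ∀ (w : allMoments μ 𝕜) (S : Finset (Fin k)),
        Integrable (fun ω => (w : Ω → 𝕜) ω * ∏ j ∈ S, (Y j : Ω → 𝕜) ω) μ := fun w S =>
      integrable_of_mem_allMoments
        (mul_mem_allMoments w.2 (prod_mem_allMoments S fun j _ => (Y j).2))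
    rw [coe_update_allMoments, coe_update_allMoments, coe_update_allMoments,
      jointCumulant_update, jointCumulant_update, jointCumulant_update,
      ← Finset.sum_add_distrib]
    refine Finset.sum_congr rfl fun π _ => ?_
    rw [← mul_add, ← mul_add, ← integral_add (hint u _) (hint v _)]
    simp only [Submodule.coe_add, Pi.add_apply, add_mul]
  map_update_smul' {dec} Y i c v := by
    have hdec : dec = instDecidableEqFin k := Subsingleton.elim _ _
    subst hdec
    rw [coe_update_allMoments, coe_update_allMoments, jointCumulant_update,
      jointCumulant_update, Finset.smul_sum]
    refine Finset.sum_congr rfl fun π _ => ?_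
    simp only [Submodule.coe_smul, Pi.smul_apply, smul_eq_mul, mul_assoc c, integral_const_mul]
    ring

theorem jointCumulant_sum [IsProbabilityMeasure μ] {k : ℕ} {α : Type*} [DecidableEq α]
    (T : Finset α) (c : Fin k → α → 𝕜) (Z : Fin k → α → Ω → 𝕜)
    (hZ : ∀ j s, Z j s ∈ allMoments μ 𝕜) :
    jointCumulant μ (fun j ω => ∑ s ∈ T, c j s * Z j s ω) =
      ∑ f ∈ Fintype.piFinset (fun _ : Fin k => T),
        (∏ j, c j (f j)) * jointCumulant μ (fun j => Z j (f j)) := by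
  have h := (jointCumulantMultilinear μ 𝕜 k).map_sum_finset
    (fun j s => c j s • (⟨Z j s, hZ j s⟩ : allMoments μ 𝕜)) (fun _ => T)
  simp only [MultilinearMap.map_smul_univ] at h
  refine Eq.trans (congrArg (jointCumulant μ) ?_) h
  ext j ω
  simp [Finset.sum_apply]

end Moments

/-! ### Summing out some of the coordinates. -/

section PartialSum

variable {V α : Type*} [Fintype V] [DecidableEq V]

/-- The sum of `f` over the coordinates in `W`, each ranging over `T`, the other coordinates
being those of `t`. -/
def partialSum (T : Finset α) (W : Finset V) (f : (V → α) → ℝ) (t : V → α) : ℝ :=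
  ∑ s ∈ Fintype.piFinset (fun v => if v ∈ W then T else {t v}), f s

theorem mem_piFinset_ite {T : Finset α} {W : Finset V} {s t : V → α} :
    s ∈ Fintype.piFinset (fun v => if v ∈ W then T else {t v}) ↔
      (∀ v ∈ W, s v ∈ T) ∧ ∀ v ∉ W, s v = t v := by
  rw [Fintype.mem_piFinset]
  constructor
  · intro h
    exact ⟨fun v hv => by simpa [hv] using h v, fun v hv => by simpa [hv] using h v⟩
  · rintro ⟨h1, h2⟩ v
    by_cases hv : v ∈ W
    · simpa [hv] using h1 v hv
    · simpa [hv] using h2 v hv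

theorem partialSum_mono {T : Finset α} {W : Finset V} {f g : (V → α) → ℝ} (h : ∀ s, f s ≤ g s)
    (t : V → α) : partialSum T W f t ≤ partialSum T W g t :=
  Finset.sum_le_sum fun s _ => h s

theorem partialSum_add (T : Finset α) (W : Finset V) (f g : (V → α) → ℝ) (t : V → α) :
    partialSum T W (fun s => f s + g s) t = partialSum T W f t + partialSum T W g t :=
  Finset.sum_add_distrib

theorem partialSum_mul_of_dependsOn {T : Finset α} {W : Finset V} {f : (V → α) → ℝ}
    {U : Finset V} (hf : DependsOn f U) (hUW : Disjoint U W) (g : (V → α) → ℝ) (t : V → α) :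
    partialSum T W (fun s => f s * g s) t = f t * partialSum T W g t := by
  rw [partialSum, partialSum, Finset.mul_sum]
  refine Finset.sum_congr rfl fun s hs => ?_
  rw [mem_piFinset_ite] at hs
  rw [hf fun v hv => hs.2 v (Finset.disjoint_left.1 hUW hv)]

theorem partialSum_mul_const (T : Finset α) (W : Finset V) (f : (V → α) → ℝ) (c : ℝ)
    (t : V → α) : partialSum T W (fun s => f s * c) t = partialSum T W f t * c := by
  rw [partialSum, partialSum, Finset.sum_mul]

theorem partialSum_union [DecidableEq α] {T : Finset α} {W₁ W₂ : Finset V}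
    (hd : Disjoint W₁ W₂) (f : (V → α) → ℝ) (t : V → α) :
    partialSum T (W₁ ∪ W₂) f t = partialSum T W₁ (partialSum T W₂ f) t := by
  simp only [partialSum]
  rw [Finset.sum_sigma']
  symm
  refine Finset.sum_nbij' (fun p => p.2) (fun s => ⟨fun v => if v ∈ W₁ then s v else t v, s⟩)
    ?_ ?_ ?_ ?_ ?_
  · rintro ⟨s, s'⟩ h
    rw [Finset.mem_sigma, mem_piFinset_ite, mem_piFinset_ite] at h
    rw [mem_piFinset_ite]
    obtain ⟨⟨h1, h2⟩, h3, h4⟩ := h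
    refine ⟨fun v hv => ?_, fun v hv => ?_⟩
    · by_cases hv2 : v ∈ W₂
      · exact h3 v hv2
      · have hv1 : v ∈ W₁ := (Finset.mem_union.1 hv).resolve_right hv2
        exact (h4 v hv2).symm ▸ h1 v hv1
    · rw [Finset.mem_union, not_or] at hv
      exact (h4 v hv.2).trans (h2 v hv.1)
  · intro s h
    rw [mem_piFinset_ite] at h
    rw [Finset.mem_sigma, mem_piFinset_ite, mem_piFinset_ite]
    refine ⟨⟨fun v hv => ?_, fun v hv => ?_⟩, fun v hv => ?_, fun v hv => ?_⟩
    · simpa [hv] using h.1 v (Finset.mem_union_left _ hv)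
    · simp [hv]
    · exact h.1 v (Finset.mem_union_right _ hv)
    · by_cases hv1 : v ∈ W₁
      · simp [hv1]
      · simpa [hv1] using h.2 v (by simp [hv, hv1])
  · rintro ⟨s, s'⟩ h
    rw [Finset.mem_sigma, mem_piFinset_ite, mem_piFinset_ite] at h
    obtain ⟨⟨h1, h2⟩, h3, h4⟩ := h
    simp only [Sigma.mk.injEq, heq_eq_eq, and_true]
    ext v
    by_cases hv : v ∈ W₁
    · simpa [hv] using h4 v (Finset.disjoint_left.1 hd hv)
    · simpa [hv] using (h2 v hv).symm
  · intro s _; rfl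
  · intro _ _; rfl

theorem partialSum_singleton (T : Finset α) (v : V) (f : (V → α) → ℝ) (t : V → α) :
    partialSum T {v} f t = ∑ u ∈ T, f (Function.update t v u) := by
  rw [partialSum]
  refine Finset.sum_nbij' (fun s => s v) (fun u => Function.update t v u) ?_ ?_ ?_ ?_ ?_
  · intro s hs
    exact (mem_piFinset_ite.1 hs).1 v (Finset.mem_singleton_self v)
  · intro u hu
    rw [mem_piFinset_ite]
    refine ⟨fun w hw => ?_, fun w hw => ?_⟩
    · rw [Finset.mem_singleton] at hw
      subst hw; simpa using hu
    · rw [Finset.mem_singleton] at hw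
      simp [hw]
  · intro s hs
    rw [mem_piFinset_ite] at hs
    ext w
    by_cases hw : w = v
    · subst hw; simp
    · simpa [hw] using (hs.2 w (by simpa using hw)).symm
  · intro u _; simp
  · intro s hs
    rw [mem_piFinset_ite] at hs
    congr 1
    ext w
    by_cases hw : w = v
    · subst hw; simp
    · simpa [hw] using (hs.2 w (by simpa using hw))

/-- With the coordinate `v` frozen the factors involve distinct coordinates, so the sum of products
is a product of sums. -/
theorem partialSum_prod_le {T : Finset α} {W : Finset V} {v : V} (hv : v ∉ W)
    (g : V → α → α → ℝ) (c : V → ℝ) (hg : ∀ w x y, 0 ≤ g w x y)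
    (hc : ∀ w x, ∑ u ∈ T, g w u x ≤ c w) (t : V → α) :
    partialSum T W (fun s => ∏ w ∈ W, g w (s w) (s v)) t ≤ ∏ w ∈ W, c w := by
  have h1 : partialSum T W (fun s => ∏ w ∈ W, g w (s w) (s v)) t =
      ∏ w : V, ∑ u ∈ (if w ∈ W then T else {t w}), if w ∈ W then g w u (t v) else 1 := by
    rw [Finset.prod_univ_sum, partialSum]
    refine Finset.sum_congr rfl fun s hs => ?_
    rw [mem_piFinset_ite] at hs
    simp [hs.2 v hv, Finset.prod_ite_mem]
  have h2 : ∏ w ∈ W, c w = ∏ w : V, if w ∈ W then c w else 1 := by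
    simp [Finset.prod_ite_mem]
  rw [h1, h2]
  refine Finset.prod_le_prod (fun w _ => Finset.sum_nonneg fun u _ => ?_) fun w _ => ?_
  · split_ifs
    · exact hg _ _ _
    · exact zero_le_one
  · by_cases hw : w ∈ W
    · simpa [hw] using hc w (t v)
    · simp [hw]

/-- Summing a product of two factors that involve disjoint sets of variables and are linked by a
kernel in one variable of each. -/
theorem partialSum_linked_le [DecidableEq α] {T : Finset α} {W₁ W₂ : Finset V}
    (hd : Disjoint W₁ W₂) {v p q : V} (hv : v ∈ W₁) (hp : p ∈ W₁) (hq : q ∈ W₂)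
    {f₁ f₂ : (V → α) → ℝ} (h₁ : DependsOn f₁ W₁) (hf₁ : ∀ s, 0 ≤ f₁ s)
    {k : α → α → ℝ} (hk : ∀ x y, 0 ≤ k x y)
    {c₁ c₂ c : ℝ} (hc₂0 : 0 ≤ c₂) (hc0 : 0 ≤ c)
    (hc₁ : ∀ t, partialSum T (W₁.erase v) f₁ t ≤ c₁)
    (hc₂ : ∀ t, partialSum T (W₂.erase q) f₂ t ≤ c₂)
    (hc : ∀ x, ∑ u ∈ T, k x u ≤ c) (t : V → α) :
    partialSum T ((W₁ ∪ W₂).erase v) (fun s => f₁ s * f₂ s * k (s p) (s q)) t ≤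
      c₁ * c₂ * c := by
  have hvW₂ : v ∉ W₂ := Finset.disjoint_left.1 hd hv
  have hpW₂ : p ∉ W₂ := Finset.disjoint_left.1 hd hp
  have hqW₁ : q ∉ W₁ := Finset.disjoint_right.1 hd hq
  have hset : (W₁ ∪ W₂).erase v = W₁.erase v ∪ ({q} ∪ W₂.erase q) := by
    rw [Finset.erase_union_distrib, Finset.erase_eq_of_notMem hvW₂, ← Finset.insert_eq,
      Finset.insert_erase hq]
  have hd1 : Disjoint (W₁.erase v) ({q} ∪ W₂.erase q) := by
    rw [← Finset.insert_eq, Finset.insert_erase hq]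
    exact hd.mono_left (Finset.erase_subset _ _)
  have hd2 : Disjoint {q} (W₂.erase q) := by simp
  rw [hset, partialSum_union hd1]
  -- Order of summation: the rest of `W₂` with `q` frozen, then `q` against the kernel from `p`, and
  -- last `W₁`. The factor `f₁` is constant during the first two.
  have hinner : ∀ s, partialSum T ({q} ∪ W₂.erase q)
      (fun s => f₁ s * f₂ s * k (s p) (s q)) s ≤ f₁ s * (c * c₂) := by
    intro s
    have e1 : (fun s => f₁ s * f₂ s * k (s p) (s q)) =
        fun s => f₁ s * (k (s p) (s q) * f₂ s) := by ext s; ring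
    have hdd : Disjoint W₁ ({q} ∪ W₂.erase q) := by
      rw [← Finset.insert_eq, Finset.insert_erase hq]; exact hd
    rw [e1, partialSum_mul_of_dependsOn h₁ hdd]
    refine mul_le_mul_of_nonneg_left ?_ (hf₁ s)
    rw [partialSum_union hd2]
    have hk_dep : DependsOn (fun s : V → α => k (s p) (s q)) (({p, q} : Finset V) : Set V) := by
      intro x y hxy
      simp only
      rw [hxy p (by simp), hxy q (by simp)]
    have hk_disj : Disjoint ({p, q} : Finset V) (W₂.erase q) := by
      rw [Finset.disjoint_left]
      intro x hx
      rw [Finset.mem_insert, Finset.mem_singleton] at hx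
      rcases hx with rfl | rfl
      · exact fun h => hpW₂ (Finset.mem_of_mem_erase h)
      · simp
    calc partialSum T {q} (partialSum T (W₂.erase q) fun s => k (s p) (s q) * f₂ s) s
        ≤ partialSum T {q} (fun s => k (s p) (s q) * c₂) s := by
          refine partialSum_mono (fun r => ?_) s
          rw [partialSum_mul_of_dependsOn hk_dep hk_disj]
          exact mul_le_mul_of_nonneg_left (hc₂ r) (hk _ _)
      _ = (∑ u ∈ T, k (s p) u) * c₂ := by
          rw [partialSum_mul_const, partialSum_singleton]
          congr 1
          refine Finset.sum_congr rfl fun u _ => ?_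
          rw [Function.update_of_ne (ne_of_mem_of_not_mem hp hqW₁), Function.update_self]
      _ ≤ c * c₂ := mul_le_mul_of_nonneg_right (hc _) hc₂0
  calc _ ≤ partialSum T (W₁.erase v) (fun s => f₁ s * (c * c₂)) t := partialSum_mono hinner t
    _ = partialSum T (W₁.erase v) f₁ t * (c * c₂) := partialSum_mul_const _ _ _ _ _
    _ ≤ c₁ * (c * c₂) := mul_le_mul_of_nonneg_right (hc₁ t) (mul_nonneg hc0 hc₂0)
    _ = c₁ * c₂ * c := by ring

/-- The root coordinate is the only one without decay; it is the source of the single factor `n`. -/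
theorem sum_piFinset_le [DecidableEq α] [Inhabited α] (T : Finset α) (v : V)
    (f : (V → α) → ℝ) (c : ℝ)
    (h : ∀ t, partialSum T (Finset.univ.erase v) f t ≤ c) :
    ∑ s ∈ Fintype.piFinset (fun _ : V => T), f s ≤ T.card * c := by
  have h1 : ∑ s ∈ Fintype.piFinset (fun _ : V => T), f s =
      partialSum T ({v} ∪ Finset.univ.erase v) f (fun _ => default) := by
    rw [partialSum]
    congr 1
    rw [← Finset.insert_eq, Finset.insert_erase (Finset.mem_univ v)]
    simp
  rw [h1, partialSum_union (by simp), partialSum_singleton]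
  calc _ ≤ ∑ _u ∈ T, c := Finset.sum_le_sum fun u _ => h _
    _ = T.card * c := by simp

end PartialSum

/-! ### Riemann sums of integrable monotone envelopes. -/

section Envelope

/-- An even, nonnegative, integrable function that is non-increasing on `[0, ∞)`. -/
structure IsIntegrableEnvelope (g : ℝ → ℝ) : Prop where
  nonneg : ∀ x, 0 ≤ g x
  even : ∀ x, g (-x) = g x
  integrable : Integrable g volume
  antitone : AntitoneOn g (Set.Ici 0)

theorem IsIntegrableEnvelope.le_zero {g : ℝ → ℝ} (hg : IsIntegrableEnvelope g) (x : ℝ) :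
    g x ≤ g 0 := by
  rcases le_total 0 x with h | h
  · exact hg.antitone (Set.mem_Ici.2 le_rfl) h h
  · rw [← hg.even]
    have : 0 ≤ -x := by linarith
    exact hg.antitone (Set.mem_Ici.2 le_rfl) this this

/-- Right endpoints of a decreasing function: starting at `i + 1` avoids a boundary term at `0`. -/
theorem IsIntegrableEnvelope.sum_range_le {g : ℝ → ℝ} (hg : IsIntegrableEnvelope g) {h : ℝ}
    (hh : 0 < h) (N : ℕ) :
    ∑ i ∈ Finset.range N, g (h * ((i + 1 : ℕ) : ℝ)) ≤ h⁻¹ * ∫ x, g x := by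
  have hanti : AntitoneOn (fun x => g (h * x)) (Set.Icc 0 (0 + (N : ℝ))) := by
    intro x hx y hy hxy
    exact hg.antitone (mul_nonneg hh.le hx.1) (mul_nonneg hh.le hy.1)
      (mul_le_mul_of_nonneg_left hxy hh.le)
  have h1 := hanti.sum_le_integral
  simp only [zero_add] at h1
  refine h1.trans ?_
  rw [intervalIntegral.integral_comp_mul_left _ hh.ne', smul_eq_mul]
  refine mul_le_mul_of_nonneg_left ?_ (inv_nonneg.2 hh.le)
  rw [intervalIntegral.integral_of_le (by rw [mul_zero]; positivity)]
  exact setIntegral_le_integral hg.integrable (Eventually.of_forall hg.nonneg)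

/-- The indices on either side of `v` give at most `h⁻¹ ∫ g` each. The diagonal term `g 0` is
absorbed into a multiple of `h⁻¹`, which is what the cap `h ≤ H` is for. -/
theorem IsIntegrableEnvelope.sum_shift_le {g : ℝ → ℝ} (hg : IsIntegrableEnvelope g) {h H : ℝ}
    (hh : 0 < h) (hH : h ≤ H) (n v : ℕ) :
    ∑ u ∈ Finset.Icc 1 n, g (h * ((u : ℝ) - v)) ≤ (2 * (∫ x, g x) + H * g 0) * h⁻¹ := by
  have hle : ∀ s : Finset ℕ, ∀ f : ℕ → ℕ, Set.InjOn f s → (∀ u ∈ s, f u < n + v) →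
      (∀ u ∈ s, g (h * ((u : ℝ) - v)) = g (h * ((f u + 1 : ℕ) : ℝ))) →
      ∑ u ∈ s, g (h * ((u : ℝ) - v)) ≤ h⁻¹ * ∫ x, g x := by
    intro s f hf hlt heq
    rw [Finset.sum_congr rfl heq]
    refine le_trans ?_ (hg.sum_range_le hh (n + v))
    rw [← Finset.sum_image (f := fun i => g (h * ((i + 1 : ℕ) : ℝ))) hf]
    refine Finset.sum_le_sum_of_subset_of_nonneg ?_ fun _ _ _ => hg.nonneg _
    intro i hi
    obtain ⟨u, hu, rfl⟩ := Finset.mem_image.1 hi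
    exact Finset.mem_range.2 (hlt u hu)
  have hsub : Finset.Icc 1 n ⊆ ((Finset.Icc 1 n).filter (fun u => u < v) ∪
      (Finset.Icc 1 n).filter (fun u => v < u)) ∪ {v} := by
    intro u hu
    simp only [Finset.mem_union, Finset.mem_filter, Finset.mem_singleton, hu, true_and]
    omega
  have hA := hle ((Finset.Icc 1 n).filter (fun u => u < v)) (fun u => v - u - 1)
    (by
      intro x hx y hy hxy
      simp only [Finset.coe_filter, Set.mem_ofPred_eq] at hx hy
      simp only at hxy
      omega)
    (by
      intro u hu
      simp only [Finset.mem_filter, Finset.mem_Icc] at hu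
      omega)
    (by
      intro u hu
      simp only [Finset.mem_filter, Finset.mem_Icc] at hu
      rw [← hg.even, show v - u - 1 + 1 = v - u by omega, Nat.cast_sub hu.2.le]
      congr 1; ring)
  have hB := hle ((Finset.Icc 1 n).filter (fun u => v < u)) (fun u => u - v - 1)
    (by
      intro x hx y hy hxy
      simp only [Finset.coe_filter, Set.mem_ofPred_eq] at hx hy
      simp only at hxy
      omega)
    (by
      intro u hu
      simp only [Finset.mem_filter, Finset.mem_Icc] at hu
      omega)
    (by
      intro u hu
      simp only [Finset.mem_filter, Finset.mem_Icc] at hu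
      rw [show u - v - 1 + 1 = u - v by omega, Nat.cast_sub hu.2.le])
  have hnn : ∀ u : ℕ, 0 ≤ g (h * ((u : ℝ) - v)) := fun u => hg.nonneg _
  have h1 := Finset.sum_le_sum_of_subset_of_nonneg hsub
    (f := fun u : ℕ => g (h * ((u : ℝ) - v))) (fun u _ _ => hnn u)
  have hun : ∀ s t : Finset ℕ, ∑ u ∈ s ∪ t, g (h * ((u : ℝ) - v)) ≤
      ∑ u ∈ s, g (h * ((u : ℝ) - v)) + ∑ u ∈ t, g (h * ((u : ℝ) - v)) := by
    intro s t
    rw [← Finset.sum_union_inter]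
    exact le_add_of_nonneg_right (Finset.sum_nonneg fun u _ => hnn u)
  have h2 := hun ((Finset.Icc 1 n).filter (fun u => u < v) ∪
      (Finset.Icc 1 n).filter (fun u => v < u)) {v}
  have h3 := hun ((Finset.Icc 1 n).filter (fun u => u < v))
      ((Finset.Icc 1 n).filter (fun u => v < u))
  rw [Finset.sum_singleton, sub_self, mul_zero] at h2
  have h4 : g 0 ≤ H * g 0 * h⁻¹ := by
    have : 1 ≤ H * h⁻¹ := by rw [← div_eq_mul_inv, one_le_div hh]; exact hH
    nlinarith [hg.nonneg 0]
  calc _ ≤ h⁻¹ * (∫ x, g x) + h⁻¹ * (∫ x, g x) + H * g 0 * h⁻¹ := by linarith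
    _ = _ := by ring

end Envelope

/-! ### Calculus of power-counting bounds. -/

section HasSumBound

variable {V : Type*} [Fintype V] [DecidableEq V]

/-- The sums of `f b ρ` over all coordinates in `W` but `v` are of order
`ρ ^ (|W| - 1) * (ρ * b) ^ (-e)`, uniformly for `ρ ≥ ρ₀` and `ρ * b ≤ D`. -/
def HasSumBound (D ρ₀ : ℝ) (f : ℝ → ℝ → (V → ℕ) → ℝ) (W : Finset V) (v : V) (e : ℤ) : Prop :=
  ∃ C, 0 ≤ C ∧ ∀ (n : ℕ) (b ρ : ℝ), 0 < b → ρ₀ ≤ ρ → ρ * b ≤ D → ∀ t : V → ℕ,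
    partialSum (Finset.Icc 1 n) (W.erase v) (f b ρ) t ≤
      C * (ρ ^ (W.erase v).card * (D / (ρ * b)) ^ e)

variable {D ρ₀ : ℝ} {f g : ℝ → ℝ → (V → ℕ) → ℝ} {W : Finset V} {v : V} {e e' : ℤ}

theorem HasSumBound.mono (hg : HasSumBound D ρ₀ g W v e)
    (h : ∀ b ρ, 0 < b → ρ₀ ≤ ρ → ρ * b ≤ D → ∀ t, f b ρ t ≤ g b ρ t) :
    HasSumBound D ρ₀ f W v e := by
  obtain ⟨C, hC, H⟩ := hg
  exact ⟨C, hC, fun n b ρ hb hρ hρb t =>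
    (partialSum_mono (h b ρ hb hρ hρb) t).trans (H n b ρ hb hρ hρb t)⟩

/-- The normalisation by `D` makes the base `D / (ρ * b)` at least 1, so exponents may be raised
freely. -/
theorem HasSumBound.mono_exponent (hρ₀ : 0 < ρ₀) (hf : HasSumBound D ρ₀ f W v e)
    (he : e ≤ e') : HasSumBound D ρ₀ f W v e' := by
  obtain ⟨C, hC, H⟩ := hf
  refine ⟨C, hC, fun n b ρ hb hρ hρb t => (H n b ρ hb hρ hρb t).trans ?_⟩
  have hρ0 : 0 < ρ := hρ₀.trans_le hρ
  have hx : 1 ≤ D / (ρ * b) := by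
    rw [one_le_div (mul_pos hρ0 hb)]; exact hρb
  have := zpow_le_zpow_right₀ hx he
  gcongr

theorem HasSumBound.add (hf : HasSumBound D ρ₀ f W v e) (hg : HasSumBound D ρ₀ g W v e) :
    HasSumBound D ρ₀ (fun b ρ t => f b ρ t + g b ρ t) W v e := by
  obtain ⟨C, hC, H⟩ := hf
  obtain ⟨C', hC', H'⟩ := hg
  refine ⟨C + C', add_nonneg hC hC', fun n b ρ hb hρ hρb t => ?_⟩
  rw [partialSum_add, add_mul]
  exact add_le_add (H n b ρ hb hρ hρb t) (H' n b ρ hb hρ hρb t)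

theorem HasSumBound.sum {κ : Type*} (I : Finset κ) {f : κ → ℝ → ℝ → (V → ℕ) → ℝ}
    (hf : ∀ i ∈ I, HasSumBound D ρ₀ (f i) W v e) :
    HasSumBound D ρ₀ (fun b ρ t => ∑ i ∈ I, f i b ρ t) W v e := by
  classical
  induction I using Finset.induction_on with
  | empty => exact ⟨0, le_rfl, fun n b ρ _ _ _ t => by simp [partialSum]⟩
  | insert i I hi ih =>
    simp only [Finset.sum_insert hi]
    exact (hf i (Finset.mem_insert_self _ _)).add
      (ih fun j hj => hf j (Finset.mem_insert_of_mem hj))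

theorem HasSumBound.mul_const (hf : HasSumBound D ρ₀ f W v e) {c : ℝ} (hc : 0 ≤ c) :
    HasSumBound D ρ₀ (fun b ρ t => f b ρ t * c) W v e := by
  obtain ⟨C, hC, H⟩ := hf
  refine ⟨C * c, mul_nonneg hC hc, fun n b ρ hb hρ hρb t => ?_⟩
  rw [partialSum_mul_const]
  refine (mul_le_mul_of_nonneg_right (H n b ρ hb hρ hρb t) hc).trans_eq ?_
  ring

/-- Spacing `b ≤ D / ρ₀` costs a multiple of `b⁻¹`, written as one factor `ρ` and one factor `D / (ρ
* b)`. -/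
theorem IsIntegrableEnvelope.exists_sum_kernel_le {K₁ : ℝ → ℝ} (hK : IsIntegrableEnvelope K₁)
    (hD : 0 < D) (hρ₀ : 0 < ρ₀) :
    ∃ C, 0 ≤ C ∧ ∀ (n : ℕ) (b ρ : ℝ), 0 < b → ρ₀ ≤ ρ → ρ * b ≤ D → ∀ x : ℕ,
      ∑ u ∈ Finset.Icc 1 n, K₁ (b * ((u : ℝ) - x)) ≤ C * (ρ * (D / (ρ * b))) := by
  have hI : 0 ≤ ∫ x, K₁ x := integral_nonneg hK.nonneg
  have h0 := hK.nonneg 0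
  refine ⟨(2 * (∫ x, K₁ x) + D / ρ₀ * K₁ 0) / D, by positivity, fun n b ρ hb hρ hρb x => ?_⟩
  have hρ0 : 0 < ρ := hρ₀.trans_le hρ
  have hbH : b ≤ D / ρ₀ := by
    rw [le_div_iff₀ hρ₀]; nlinarith
  refine (hK.sum_shift_le hb hbH n x).trans_eq ?_
  field_simp

/-- Two families of variables linked by a kernel in one variable of each. -/
theorem HasSumBound.linked {K₁ : ℝ → ℝ} (hK : IsIntegrableEnvelope K₁) (hD : 0 < D)
    (hρ₀ : 0 < ρ₀) {W₁ W₂ : Finset V} (hd : Disjoint W₁ W₂) {p q : V} (hv : v ∈ W₁)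
    (hp : p ∈ W₁) (hq : q ∈ W₂) {f₁ f₂ : ℝ → ℝ → (V → ℕ) → ℝ}
    (hdep : ∀ b ρ, DependsOn (f₁ b ρ) W₁) (hf₁ : ∀ b ρ s, 0 ≤ f₁ b ρ s) {e₁ e₂ : ℤ}
    (h₁ : HasSumBound D ρ₀ f₁ W₁ v e₁) (h₂ : HasSumBound D ρ₀ f₂ W₂ q e₂) :
    HasSumBound D ρ₀ (fun b ρ t => f₁ b ρ t * f₂ b ρ t * K₁ (b * ((t p : ℝ) - t q)))
      (W₁ ∪ W₂) v (e₁ + e₂ + 1) := by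
  obtain ⟨C₁, hC₁, H₁⟩ := h₁
  obtain ⟨C₂, hC₂, H₂⟩ := h₂
  obtain ⟨C, hC, H⟩ := hK.exists_sum_kernel_le hD hρ₀
  refine ⟨C₁ * C₂ * C, by positivity, fun n b ρ hb hρ hρb t => ?_⟩
  have hρ0 : 0 < ρ := hρ₀.trans_le hρ
  have hx : 0 < D / (ρ * b) := by positivity
  have h := partialSum_linked_le (T := Finset.Icc 1 n) hd hv hp hq (hdep b ρ) (hf₁ b ρ)
    (k := fun x y : ℕ => K₁ (b * ((x : ℝ) - y))) (fun _ _ => hK.nonneg _)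
    (by positivity) (by positivity) (H₁ n b ρ hb hρ hρb) (H₂ n b ρ hb hρ hρb)
    (c := C * (ρ * (D / (ρ * b))))
    (fun x => by
      refine le_trans (le_of_eq ?_) (H n b ρ hb hρ hρb x)
      refine Finset.sum_congr rfl fun u _ => ?_
      rw [← hK.even]; congr 1; ring) t
  refine h.trans_eq ?_
  have hcard : ((W₁ ∪ W₂).erase v).card = (W₁.erase v).card + (W₂.erase q).card + 1 := by
    have h1 := Finset.card_erase_add_one hv
    have h2 := Finset.card_erase_add_one hq
    have h3 := Finset.card_erase_add_one (Finset.mem_union_left W₂ hv)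
    have h4 := Finset.card_union_of_disjoint hd
    omega
  rw [hcard, zpow_add₀ hx.ne', zpow_add₀ hx.ne', zpow_one]
  ring

/-- Spacing `ρ⁻¹ ≤ ρ₀⁻¹` costs one factor `ρ` per summed coordinate and nothing else, hence exponent
0. -/
theorem HasSumBound.of_prod_envelope (hρ₀ : 0 < ρ₀) {g : V → ℝ → ℝ}
    (hg : ∀ w, IsIntegrableEnvelope (g w)) {k : ℝ → ℝ → (V → ℕ) → ℝ}
    (h : ∀ b ρ, 0 < b → ρ₀ ≤ ρ → ρ * b ≤ D → ∀ t : V → ℕ,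
      k b ρ t ≤ ∏ w ∈ W.erase v, g w (ρ⁻¹ * ((t w : ℝ) - t v))) :
    HasSumBound D ρ₀ k W v 0 := by
  have hI : ∀ w, 0 ≤ ∫ x, g w x := fun w => integral_nonneg (hg w).nonneg
  have h0 : ∀ w, 0 ≤ g w 0 := fun w => (hg w).nonneg 0
  have hc : ∀ w, 0 ≤ 2 * (∫ x, g w x) + ρ₀⁻¹ * g w 0 := fun w => by
    have := hI w; have := h0 w; positivity
  refine ⟨∏ w ∈ W.erase v, (2 * (∫ x, g w x) + ρ₀⁻¹ * g w 0),
    Finset.prod_nonneg fun w _ => hc w, fun n b ρ hb hρ hρb t => ?_⟩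
  have hρ0 : 0 < ρ := hρ₀.trans_le hρ
  refine (partialSum_mono (h b ρ hb hρ hρb) t).trans ?_
  refine (partialSum_prod_le (Finset.notMem_erase v W)
    (fun w (x y : ℕ) => g w (ρ⁻¹ * ((x : ℝ) - y)))
    (fun w => (2 * (∫ x, g w x) + ρ₀⁻¹ * g w 0) * (ρ⁻¹)⁻¹) (fun w _ _ => (hg w).nonneg _)
    (fun w x => (hg w).sum_shift_le (inv_pos.2 hρ0) (inv_anti₀ hρ₀ hρ) n x) t).trans_eq ?_
  rw [Finset.prod_mul_distrib, inv_inv, Finset.prod_const]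
  simp

end HasSumBound

/-! ### Domination of the process cumulants by envelopes. -/

section Dominance

variable {Ω : Type*} [MeasurableSpace Ω] {μ : Measure Ω} {r : ℕ} {X : Fin r → ℝ → Ω → ℝ}

theorem antitoneOn_Ici_of_continuous {g : ℝ → ℝ} (hc : Continuous g)
    (h : AntitoneOn g (Set.Ioi 0)) : AntitoneOn g (Set.Ici 0) := by
  intro x hx y hy hxy
  rcases hxy.eq_or_lt with rfl | hlt
  · exact le_rfl
  rcases (Set.mem_Ici.1 hx).eq_or_lt with rfl | hx0
  · refine ge_of_tendsto ((hc.tendsto 0).mono_left nhdsWithin_le_nhds : Tendsto g (𝓝[>] 0) _) ?_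
    filter_upwards [Ioo_mem_nhdsGT hlt] with z hz
    exact h hz.1 hlt hz.2.le
  · exact h hx0 (hx0.trans hlt) hxy

/-- From `|xy| ≤ (x² + y²)/2` and stationarity. Boundedness makes the `sSup` in `covEnvelope` a true
supremum and not the default value 0. -/
theorem IsMeanSquareContinuousStationary.abs_crossCov_le
    (hX : IsMeanSquareContinuousStationary μ X) (a₁ a₂ : Fin r) (s : ℝ) :
    |crossCov μ X a₁ a₂ s| ≤ (crossCov μ X a₁ a₁ 0 + crossCov μ X a₂ a₂ 0) / 2 := by
  have hi : ∀ a t, Integrable (fun ω => X a t ω * X a t ω) μ := fun a t =>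
    (hX.memLp_two a t).integrable_mul (hX.memLp_two a t)
  have h1 : crossCov μ X a₁ a₁ 0 = ∫ ω, X a₁ (0 + s) ω * X a₁ (0 + s) ω ∂μ := by
    have := hX.stationary a₁ a₁ 0 0 (0 + s)
    simpa [crossCov] using this
  have h2 : crossCov μ X a₂ a₂ 0 = ∫ ω, X a₂ 0 ω * X a₂ 0 ω ∂μ := by
    simp [crossCov]
  rw [h1, h2, ← integral_add (hi _ _) (hi _ _), crossCov, ← integral_div]
  refine abs_integral_le_integral_abs.trans (integral_mono ?_ ?_ fun ω => ?_)
  · exact ((hX.memLp_two a₁ _).integrable_mul (hX.memLp_two a₂ _)).abs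
  · exact ((hi _ _).add (hi _ _)).div_const 2
  · simp only
    rw [abs_le]
    constructor
    · nlinarith [sq_nonneg (X a₁ (0 + s) ω + X a₂ 0 ω)]
    · nlinarith [sq_nonneg (X a₁ (0 + s) ω - X a₂ 0 ω)]

theorem IsMeanSquareContinuousStationary.bddAbove_crossCov
    (hX : IsMeanSquareContinuousStationary μ X) (a₁ a₂ : Fin r) (t : ℝ) :
    BddAbove {c : ℝ | ∃ s : ℝ, |t| ≤ |s| ∧ c = |crossCov μ X a₁ a₂ s|} := by
  refine ⟨(crossCov μ X a₁ a₁ 0 + crossCov μ X a₂ a₂ 0) / 2, ?_⟩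
  rintro _ ⟨s, -, rfl⟩
  exact hX.abs_crossCov_le a₁ a₂ s

theorem IsMeanSquareContinuousStationary.isIntegrableEnvelope_covEnvelope
    (hX : IsMeanSquareContinuousStationary μ X) (h : HasIntegrableCovEnvelopes μ X)
    (a₁ a₂ : Fin r) : IsIntegrableEnvelope (covEnvelope μ X a₁ a₂) where
  nonneg t := by
    refine Real.sSup_nonneg ?_
    rintro _ ⟨s, -, rfl⟩
    exact abs_nonneg _
  even t := by simp [covEnvelope]
  integrable := h a₁ a₂
  antitone := by
    intro x hx y hy hxy
    refine csSup_le_csSup (hX.bddAbove_crossCov a₁ a₂ x) ⟨_, y, le_rfl, rfl⟩ ?_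
    rintro _ ⟨s, hs, rfl⟩
    refine ⟨s, le_trans ?_ hs, rfl⟩
    rwa [abs_of_nonneg hx, abs_of_nonneg hy]

theorem IsMeanSquareContinuousStationary.abs_integral_mul_le
    (hX : IsMeanSquareContinuousStationary μ X) (a₁ a₂ : Fin r) (s t : ℝ) :
    |∫ ω, X a₁ s ω * X a₂ t ω ∂μ| ≤ covEnvelope μ X a₁ a₂ (s - t) := by
  have h := hX.stationary a₁ a₂ (s - t) t 0
  rw [add_sub_cancel] at h
  rw [h]
  exact le_csSup (hX.bddAbove_crossCov a₁ a₂ (s - t)) ⟨s - t, le_rfl, rfl⟩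

theorem isIntegrableEnvelope_zero : IsIntegrableEnvelope (fun _ => 0) :=
  ⟨fun _ => le_rfl, fun _ => rfl, integrable_zero _ _ _, fun _ _ _ _ _ => le_rfl⟩

/-- The joint cumulants of all orders of a zero mean process with dominated cumulants are
dominated by a product of envelopes of the time differences. -/
theorem HasDominatedCumulants.exists_envelopes [IsProbabilityMeasure μ]
    (hX : IsMeanSquareContinuousStationary μ X) (h1 : HasIntegrableCovEnvelopes μ X)
    (h5 : HasDominatedCumulants μ X) {V : Type*} [DecidableEq V] (c : V → Fin r)
    {I : Finset V} {v : V} (hv : v ∈ I) :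
    ∃ g : V → ℝ → ℝ, (∀ w, IsIntegrableEnvelope (g w)) ∧ ∀ τ : V → ℝ,
      |setCumulant (jointMoment μ (fun w => X (c w) (τ w))) I| ≤
        (if I.card ≤ 1 then 0 else 1) * ∏ w ∈ I.erase v, g w (τ w - τ v) := by
  have hpos : 0 < I.card := Finset.card_pos.2 ⟨v, hv⟩
  -- Order one vanishes by zero mean, order two is a covariance, and higher orders are covered by
  -- the domination hypothesis.
  rcases lt_trichotomy I.card 2 with hlt | heq | hgt
  · refine ⟨fun _ _ => 0, fun _ => isIntegrableEnvelope_zero, fun τ => ?_⟩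
    obtain ⟨w, rfl⟩ := Finset.card_eq_one.1 (by omega : I.card = 1)
    rw [setCumulant_singleton _ (jointMoment_empty _)]
    simp [jointMoment, hX.mean_zero]
  · obtain ⟨w, hw⟩ := Finset.card_eq_one.1
      (show (I.erase v).card = 1 by rw [Finset.card_erase_of_mem hv, heq])
    have hwv : w ≠ v := fun h => by
      have : w ∈ I.erase v := by rw [hw]; exact Finset.mem_singleton_self w
      exact Finset.ne_of_mem_erase this h
    refine ⟨fun w => covEnvelope μ X (c w) (c v),
      fun w => hX.isIntegrableEnvelope_covEnvelope h1 _ _, fun τ => ?_⟩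
    have hI : I = {w, v} := by
      rw [← Finset.insert_erase hv, hw, Finset.pair_comm]
    rw [hw, if_neg (by omega), hI, setCumulant_pair _ (jointMoment_empty _) hwv]
    simp only [jointMoment, Finset.prod_singleton, hX.mean_zero, mul_zero, sub_zero,
      Finset.prod_pair hwv, one_mul]
    exact hX.abs_integral_mul_le _ _ _ _
  · obtain ⟨m, hm⟩ : ∃ m, I.card = m + 1 := ⟨I.card - 1, by omega⟩
    let e₀ : Fin (m + 1) ≃ I := (I.equivFinOfCardEq hm).symm
    -- The swap puts `v` in the last position, the one with time offset 0 in the hypothesis, so any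
    -- variable can serve as the root.
    let e : Fin (m + 1) ≃ I := (Equiv.swap (Fin.last m) (e₀.symm ⟨v, hv⟩)).trans e₀
    have hlast : e (Fin.last m) = ⟨v, hv⟩ := by simp [e]
    let f : Fin (m + 1) ↪ V := e.toEmbedding.trans (Function.Embedding.subtype _)
    have hf : Finset.univ.map f = I := by
      ext w
      simp only [Finset.mem_map, Finset.mem_univ, true_and, f, Function.Embedding.trans_apply,
        Equiv.coe_toEmbedding, Function.Embedding.subtype_apply]
      constructor
      · rintro ⟨i, rfl⟩; exact (e i).2
      · intro hw; exact ⟨e.symm ⟨w, hw⟩, by simp⟩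
    have hflast : f (Fin.last m) = v := by
      change ((e (Fin.last m) : I) : V) = v
      rw [hlast]
    obtain ⟨g, hg, hbound⟩ := h5.cumulants m (by omega) (fun j => c (f j))
    have hg' : ∀ i, IsIntegrableEnvelope (g i) := fun i =>
      ⟨(hg i).2.2.1, (hg i).2.1, (hg i).2.2.2.1,
        antitoneOn_Ici_of_continuous (hg i).1 (hg i).2.2.2.2⟩
    let f' : Fin m ↪ V := Fin.castSuccEmb.trans f
    have herase : I.erase v = Finset.univ.map f' := by
      ext w
      simp only [Finset.mem_erase, ← hf, Finset.mem_map, Finset.mem_univ, true_and]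
      constructor
      · rintro ⟨hwv, j, rfl⟩
        rcases Fin.eq_castSucc_or_eq_last j with ⟨i, rfl⟩ | rfl
        · exact ⟨i, rfl⟩
        · exact absurd hflast hwv
      · rintro ⟨i, rfl⟩
        refine ⟨fun h => ?_, i.castSucc, rfl⟩
        rw [← hflast] at h
        exact (Fin.castSucc_lt_last i).ne (f.injective h)
    classical
    refine ⟨fun w => if h : ∃ i, f' i = w then g h.choose else fun _ => 0, fun w => ?_,
      fun τ => ?_⟩
    · simp only
      split_ifs with h
      · exact hg' _
      · exact isIntegrableEnvelope_zero
    · have hb := hbound (fun i => τ (f' i) - τ v) (τ v)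
      have hY : (fun j : Fin (m + 1) => X (c (f j))
          ((Fin.snoc (fun i => τ (f' i) - τ v) 0 : Fin (m + 1) → ℝ) j + τ v)) =
          fun j => (fun w => X (c w) (τ w)) (f j) := by
        funext j
        rcases Fin.eq_castSucc_or_eq_last j with ⟨i, rfl⟩ | rfl
        · simp [Fin.snoc_castSucc, f']
        · simp [Fin.snoc_last, hflast]
      rw [hY, jointCumulant_eq_setCumulant_map (fun w => X (c w) (τ w)) f, hf] at hb
      rw [if_neg (by omega), one_mul, herase, Finset.prod_map]
      refine hb.trans_eq (Finset.prod_congr rfl fun i _ => ?_)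
      have hex : ∃ i', f' i' = f' i := ⟨i, rfl⟩
      simp only [dif_pos hex]
      congr 2
      exact (f'.injective hex.choose_spec).symm

end Dominance

/-! ### Opening the pairs one by one. -/

section MixedCumulant

variable {Ω : Type*} [MeasurableSpace Ω] {μ : Measure Ω} {r : ℕ} {X : Fin r → ℝ → Ω → ℝ}
  {L : ℕ} {c : Fin L × Bool → Fin r} {K₁ : ℝ → ℝ}

/-- The family that consists of all variables of a process at the times `τ`, and of the products
of the two variables of each pair. -/
def pairOrSingle (X : Fin r → ℝ → Ω → ℝ) (c : Fin L × Bool → Fin r) (τ : Fin L × Bool → ℝ) :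
    Fin L ⊕ (Fin L × Bool) → Ω → ℝ
  | .inl j => fun ω => X (c (j, false)) (τ (j, false)) ω * X (c (j, true)) (τ (j, true)) ω
  | .inr w => X (c w) (τ w)

/-- The joint cumulant of the products over the pairs in `J` and the single variables in `I`. -/
def mixedCumulant (μ : Measure Ω) (X : Fin r → ℝ → Ω → ℝ) (c : Fin L × Bool → Fin r)
    (J : Finset (Fin L)) (I : Finset (Fin L × Bool)) (τ : Fin L × Bool → ℝ) : ℝ :=
  setCumulant (jointMoment μ (pairOrSingle X c τ)) (J.disjSum I)

/-- The variables that occur in the pairs in `J` or as singles in `I`. -/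
def mixedVars (J : Finset (Fin L)) (I : Finset (Fin L × Bool)) : Finset (Fin L × Bool) :=
  J ×ˢ Finset.univ ∪ I

theorem mem_mixedVars {J : Finset (Fin L)} {I : Finset (Fin L × Bool)} {w : Fin L × Bool} :
    w ∈ mixedVars J I ↔ w.1 ∈ J ∨ w ∈ I := by
  simp [mixedVars]

theorem setCumulant_congr {ι R : Type*} [DecidableEq ι] [CommRing R] {M M' : Finset ι → R}
    {S : Finset ι} (h : ∀ B ⊆ S, M B = M' B) : setCumulant M S = setCumulant M' S := by
  refine Finset.sum_congr rfl fun π _ => ?_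
  congr 1
  exact Finset.prod_congr rfl fun B hB => h B (π.le hB)

theorem dependsOn_mixedCumulant (J : Finset (Fin L)) (I : Finset (Fin L × Bool)) :
    DependsOn (mixedCumulant μ X c J I) (mixedVars J I) := by
  intro τ τ' h
  refine setCumulant_congr fun B hB => ?_
  refine integral_congr_ae (Eventually.of_forall fun ω => ?_)
  refine Finset.prod_congr rfl fun i hi => ?_
  have hi' := hB hi
  rcases i with j | w
  · rw [Finset.inl_mem_disjSum] at hi'
    simp only [pairOrSingle]
    rw [h (j, false) (mem_mixedVars.2 (Or.inl hi')), h (j, true) (mem_mixedVars.2 (Or.inl hi'))]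
  · rw [Finset.inr_mem_disjSum] at hi'
    simp only [pairOrSingle]
    rw [h w (mem_mixedVars.2 (Or.inr hi'))]

theorem mixedCumulant_empty [IsProbabilityMeasure μ] {I : Finset (Fin L × Bool)}
    (hI : I.Nonempty) (τ : Fin L × Bool → ℝ) :
    mixedCumulant μ X c ∅ I τ = setCumulant (jointMoment μ (fun w => X (c w) (τ w))) I := by
  rw [mixedCumulant, Finset.empty_disjSum, setCumulant_map _ _ (jointMoment_empty _) hI]
  congr 1
  ext T
  simp [jointMoment, Finset.prod_map, pairOrSingle]

/-- Splitting a pair: the two variables either stay in a common cumulant, or are distributed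
over two cumulants. -/
theorem mixedCumulant_split [IsProbabilityMeasure μ] {J : Finset (Fin L)}
    {I : Finset (Fin L × Bool)} {j : Fin L} (hj : j ∈ J) (hI : ∀ w ∈ I, w.1 ∉ J)
    (τ : Fin L × Bool → ℝ) :
    mixedCumulant μ X c J I τ =
      mixedCumulant μ X c (J.erase j) (insert (j, false) (insert (j, true) I)) τ +
      ∑ A ∈ ((J.erase j).disjSum I).powerset,
        mixedCumulant μ X c A.toLeft (insert (j, false) A.toRight) τ *
        mixedCumulant μ X c (J.erase j \ A.toLeft) (insert (j, true) (I \ A.toRight)) τ := by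
  have hjI : ∀ d, (j, d) ∉ I := fun d h => hI _ h hj
  have key := setCumulant_insert_of_moment_eq (jointMoment μ (pairOrSingle X c τ))
    (jointMoment_empty _) (S := (J.erase j).disjSum I) (x := Sum.inr (j, false))
    (y := Sum.inr (j, true)) (z := Sum.inl j) (by simp [hjI]) (by simp [hjI]) (by simp)
    (by simp) ?_
  · have hL : ∀ (J : Finset (Fin L)) (I : Finset (Fin L × Bool)) (w : Fin L × Bool),
        insert (Sum.inr w) (J.disjSum I) = J.disjSum (insert w I) := by
      intro J I w; ext (k | k) <;> simp
    have h0 : insert (Sum.inl j) ((J.erase j).disjSum I) = J.disjSum I := by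
      ext (k | k)
      · by_cases hk : k = j <;> simp [hk, hj]
      · simp
    rw [h0, hL, hL] at key
    rw [mixedCumulant, key]
    congr 1
    refine Finset.sum_congr rfl fun A _ => ?_
    congr 1
    · rw [mixedCumulant, ← hL, Finset.toLeft_disjSum_toRight]
    · rw [mixedCumulant, ← hL]
      congr 2
      ext (k | k) <;> simp
  · intro S hS
    have h1 : Sum.inl j ∉ S := fun h => by simpa using hS h
    have h2 : ∀ d, Sum.inr (j, d) ∉ S := fun d h => by simpa [hjI] using hS h
    have h3 : (Sum.inr (j, false) : Fin L ⊕ (Fin L × Bool)) ∉ insert (Sum.inr (j, true)) S := by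
      simp [h2]
    refine integral_congr_ae (Eventually.of_forall fun ω => ?_)
    simp only
    rw [Finset.prod_insert h1, Finset.prod_insert h3, Finset.prod_insert (h2 _)]
    simp only [pairOrSingle]
    ring

/-- The absolute joint cumulant of the pairs in `J` and the singles in `I`, sampled at rate `ρ`,
weighted with the kernel for each pair. -/
def kernelWeight (μ : Measure Ω) (X : Fin r → ℝ → Ω → ℝ) (c : Fin L × Bool → Fin r)
    (K₁ : ℝ → ℝ) (J : Finset (Fin L)) (I : Finset (Fin L × Bool)) (b ρ : ℝ)
    (t : Fin L × Bool → ℕ) : ℝ :=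
  (∏ j ∈ J, K₁ (b * ((t (j, false) : ℝ) - t (j, true)))) *
    |mixedCumulant μ X c J I (fun w => t w / ρ)|

theorem kernelWeight_nonneg (hK : IsIntegrableEnvelope K₁) (J : Finset (Fin L))
    (I : Finset (Fin L × Bool)) (b ρ : ℝ) (t : Fin L × Bool → ℕ) :
    0 ≤ kernelWeight μ X c K₁ J I b ρ t :=
  mul_nonneg (Finset.prod_nonneg fun _ _ => hK.nonneg _) (abs_nonneg _)

theorem dependsOn_kernelWeight (J : Finset (Fin L)) (I : Finset (Fin L × Bool)) (b ρ : ℝ) :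
    DependsOn (kernelWeight μ X c K₁ J I b ρ) (mixedVars J I) := by
  intro t t' h
  simp only [kernelWeight]
  congr 1
  · refine Finset.prod_congr rfl fun j hj => ?_
    rw [h (j, false) (mem_mixedVars.2 (Or.inl hj)), h (j, true) (mem_mixedVars.2 (Or.inl hj))]
  · rw [dependsOn_mixedCumulant J I fun w hw => by rw [h w hw]]

theorem kernelWeight_split_le [IsProbabilityMeasure μ] (hK : IsIntegrableEnvelope K₁)
    {J : Finset (Fin L)} {I : Finset (Fin L × Bool)} {j : Fin L} (hj : j ∈ J)
    (hI : ∀ w ∈ I, w.1 ∉ J) (b ρ : ℝ) (t : Fin L × Bool → ℕ) :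
    kernelWeight μ X c K₁ J I b ρ t ≤
      kernelWeight μ X c K₁ (J.erase j) (insert (j, false) (insert (j, true) I)) b ρ t * K₁ 0 +
      ∑ A ∈ ((J.erase j).disjSum I).powerset,
        kernelWeight μ X c K₁ A.toLeft (insert (j, false) A.toRight) b ρ t *
        kernelWeight μ X c K₁ (J.erase j \ A.toLeft) (insert (j, true) (I \ A.toRight)) b ρ t *
        K₁ (b * ((t (j, false) : ℝ) - t (j, true))) := by
  have hP : ∀ J : Finset (Fin L), 0 ≤ ∏ j ∈ J, K₁ (b * ((t (j, false) : ℝ) - t (j, true))) :=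
    fun J => Finset.prod_nonneg fun _ _ => hK.nonneg _
  rw [kernelWeight, mixedCumulant_split hj hI, ← Finset.mul_prod_erase _ _ hj]
  have habs := (abs_add_le
    (mixedCumulant μ X c (J.erase j) (insert (j, false) (insert (j, true) I)) fun w => t w / ρ)
    (∑ A ∈ ((J.erase j).disjSum I).powerset,
        mixedCumulant μ X c A.toLeft (insert (j, false) A.toRight) (fun w => t w / ρ) *
        mixedCumulant μ X c (J.erase j \ A.toLeft) (insert (j, true) (I \ A.toRight))
          (fun w => t w / ρ))).trans
    (add_le_add_right (Finset.abs_sum_le_sum_abs _ _) _)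
  refine (mul_le_mul_of_nonneg_left habs (mul_nonneg (hK.nonneg _) (hP _))).trans ?_
  rw [mul_add]
  refine add_le_add ?_ ?_
  -- Both variables stay in one cumulant, so the kernel is not needed for decay and is bounded by
  -- its maximum.
  · rw [kernelWeight]
    have := hK.le_zero (b * ((t (j, false) : ℝ) - t (j, true)))
    calc _ ≤ (K₁ 0 * ∏ j ∈ J.erase j, K₁ (b * ((t (j, false) : ℝ) - t (j, true)))) *
          |mixedCumulant μ X c (J.erase j) (insert (j, false) (insert (j, true) I))
            fun w => t w / ρ| := by
          refine mul_le_mul_of_nonneg_right ?_ (abs_nonneg _)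
          exact mul_le_mul_of_nonneg_right this (hP _)
      _ = _ := by ring
  · rw [Finset.mul_sum]
    refine le_of_eq (Finset.sum_congr rfl fun A hA => ?_)
    have hAJ : A.toLeft ⊆ J.erase j := by
      intro k hk
      simpa using Finset.mem_powerset.1 hA (Finset.mem_toLeft.1 hk)
    rw [kernelWeight, kernelWeight, abs_mul, ← Finset.prod_sdiff hAJ]
    ring

/-- If `s ≤ 1`, one of the two parts receives no old single, and its own saving of 1 is passed on.
The `+ 1` on the left is the linking kernel. -/
theorem card_mixed_exponent_le {m s m₁ m₂ s₁ s₂ : ℕ} (hm : m₁ + m₂ + 1 = m) (hs : s₁ + s₂ = s) :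
    ((m₁ : ℤ) - if s₁ + 1 ≤ 1 then 1 else 0) + ((m₂ : ℤ) - if s₂ + 1 ≤ 1 then 1 else 0) + 1 ≤
      (m : ℤ) - if s ≤ 1 then 1 else 0 := by
  split_ifs <;> omega

/-- Induction on the number of unopened pairs, for all sets of singles and all roots `v`. Each pair
may cost one factor `D / (ρ * b)`; a family with at most one single saves one, which traces back to
the vanishing of first-order cumulants. -/
theorem hasSumBound_kernelWeight [IsProbabilityMeasure μ]
    (hX : IsMeanSquareContinuousStationary μ X) (h1 : HasIntegrableCovEnvelopes μ X)
    (h5 : HasDominatedCumulants μ X) (hK : IsIntegrableEnvelope K₁) {D ρ₀ : ℝ} (hD : 0 < D)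
    (hρ₀ : 0 < ρ₀) (m : ℕ) : ∀ (J : Finset (Fin L)) (I : Finset (Fin L × Bool)), J.card = m →
      (∀ w ∈ I, w.1 ∉ J) → ∀ v ∈ mixedVars J I,
      HasSumBound D ρ₀ (kernelWeight μ X c K₁ J I) (mixedVars J I) v
        (J.card - if I.card ≤ 1 then 1 else 0) := by
  induction m using Nat.strong_induction_on with
  | _ m ih =>
  intro J I hJm hI v hv
  rcases J.eq_empty_or_nonempty with rfl | ⟨j, hj⟩
  · have hvI : v ∈ I := by simpa [mem_mixedVars] using hv
    have hvars : mixedVars ∅ I = I := by simp [mixedVars]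
    obtain ⟨g, hg, hle⟩ := h5.exists_envelopes hX h1 c hvI
    rw [hvars]
    by_cases hcard : I.card ≤ 1
    -- A lone variable has cumulant 0, so the constant 0 gives the bound with exponent -1.
    · refine ⟨0, le_rfl, fun n b ρ hb hρ hρb t => ?_⟩
      rw [zero_mul]
      refine (partialSum_mono (g := fun _ => 0) (fun s => ?_) t).trans (by simp [partialSum])
      have := hle (fun w => s w / ρ)
      rw [if_pos hcard, zero_mul] at this
      simpa [kernelWeight, mixedCumulant_empty ⟨v, hvI⟩] using this
    · rw [if_neg hcard, Finset.card_empty, Nat.cast_zero, sub_zero]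
      refine HasSumBound.of_prod_envelope hρ₀ hg fun b ρ hb hρ hρb t => ?_
      have := hle (fun w => t w / ρ)
      rw [if_neg hcard, one_mul] at this
      rw [kernelWeight, mixedCumulant_empty ⟨v, hvI⟩, Finset.prod_empty, one_mul]
      refine this.trans_eq (Finset.prod_congr rfl fun w _ => ?_)
      congr 1
      ring
  · have hjI : ∀ d, (j, d) ∉ I := fun d h => hI _ h hj
    have hcJ : (J.erase j).card + 1 = J.card := Finset.card_erase_add_one hj
    refine HasSumBound.mono ?_ fun b ρ _ _ _ t => kernelWeight_split_le hK hj hI b ρ t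
    refine HasSumBound.add (HasSumBound.mul_const ?_ (hK.nonneg 0)) (HasSumBound.sum _ ?_)
    · have hvars : mixedVars (J.erase j) (insert (j, false) (insert (j, true) I)) =
          mixedVars J I := by
        ext ⟨k, d⟩
        simp only [mem_mixedVars, Finset.mem_erase, Finset.mem_insert, Prod.mk.injEq]
        by_cases hk : k = j
        · subst hk; cases d <;> simp [hj]
        · simp [hk]
      have h := ih (m - 1) (by omega) (J.erase j) (insert (j, false) (insert (j, true) I))
        (by omega) (by
          intro w hw
          simp only [Finset.mem_insert] at hw
          rcases hw with rfl | rfl | hw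
          · simp
          · simp
          · exact fun h => hI w hw (Finset.mem_of_mem_erase h)) v (hvars ▸ hv)
      rw [hvars] at h
      -- There are now at least two singles and one pair fewer: the exponent `|J| - 1` suffices in
      -- either case.
      refine h.mono_exponent hρ₀ ?_
      have hc : (insert (j, false) (insert (j, true) I)).card = I.card + 2 := by
        rw [Finset.card_insert_of_notMem (by simp [hjI]),
          Finset.card_insert_of_notMem (hjI _)]
      rw [hc]
      split_ifs <;> omega
    · intro A hA
      have hAJ : A.toLeft ⊆ J.erase j := by
        intro k hk
        simpa using Finset.mem_powerset.1 hA (Finset.mem_toLeft.1 hk)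
      have hAI : A.toRight ⊆ I := by
        intro k hk
        simpa using Finset.mem_powerset.1 hA (Finset.mem_toRight.1 hk)
      generalize A.toLeft = J₁ at hAJ ⊢
      generalize A.toRight = I₁ at hAI ⊢
      have hJ1 : J₁.card ≤ (J.erase j).card := Finset.card_le_card hAJ
      have hI1 : I₁.card ≤ I.card := Finset.card_le_card hAI
      have hJ2 : (J.erase j \ J₁).card = (J.erase j).card - J₁.card :=
        Finset.card_sdiff_of_subset hAJ
      have hI2 : (I \ I₁).card = I.card - I₁.card := Finset.card_sdiff_of_subset hAI
      have hc1 : (insert (j, false) I₁).card = I₁.card + 1 :=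
        Finset.card_insert_of_notMem fun h => hjI _ (hAI h)
      have hc2 : (insert (j, true) (I \ I₁)).card = (I \ I₁).card + 1 :=
        Finset.card_insert_of_notMem fun h => hjI _ (Finset.sdiff_subset h)
      have hvars : mixedVars J I = mixedVars J₁ (insert (j, false) I₁) ∪
          mixedVars (J.erase j \ J₁) (insert (j, true) (I \ I₁)) := by
        ext ⟨k, d⟩
        have h1 := @hAJ k
        have h2 := @hAI (k, d)
        simp only [Finset.mem_union, mem_mixedVars, Finset.mem_erase, Finset.mem_insert,
          Prod.mk.injEq, Finset.mem_sdiff] at h1 h2 ⊢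
        by_cases hk : k = j
        · subst hk; cases d <;> simp [hj]
        · simp only [hk, false_and, false_or, ne_eq, not_false_eq_true, true_and] at h1 ⊢
          tauto
      have hdisj : Disjoint (mixedVars J₁ (insert (j, false) I₁))
          (mixedVars (J.erase j \ J₁) (insert (j, true) (I \ I₁))) := by
        rw [Finset.disjoint_left]
        rintro ⟨k, d⟩ hw hw'
        have h1 := @hAJ k
        have h2 := @hAI (k, d)
        have h3 := hI (k, d)
        have h4 := hjI d
        simp only [mem_mixedVars, Finset.mem_erase, Finset.mem_insert,
          Prod.mk.injEq, Finset.mem_sdiff] at h1 h2 h3 hw hw'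
        by_cases hk : k = j
        · subst hk; cases d <;> simp_all
        · simp only [hk, false_and, false_or, ne_eq, not_false_eq_true, true_and] at h1 hw hw'
          tauto
      have hb1 := ih J₁.card (by omega) J₁ (insert (j, false) I₁) rfl (by
        intro w hw hw'
        rw [Finset.mem_insert] at hw
        rcases hw with rfl | hw
        · exact Finset.ne_of_mem_erase (hAJ hw') rfl
        · exact hI w (hAI hw) (Finset.mem_of_mem_erase (hAJ hw')))
      have hb2 := ih (J.erase j \ J₁).card (by omega) (J.erase j \ J₁)
        (insert (j, true) (I \ I₁)) rfl (by
        intro w hw hw'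
        have hw'' := (Finset.mem_sdiff.1 hw').1
        rw [Finset.mem_insert] at hw
        rcases hw with rfl | hw
        · exact Finset.ne_of_mem_erase hw'' rfl
        · exact hI w (Finset.sdiff_subset hw) (Finset.mem_of_mem_erase hw''))
      rw [hc1] at hb1
      rw [hc2] at hb2
      have hp : (j, false) ∈ mixedVars J₁ (insert (j, false) I₁) := by simp [mem_mixedVars]
      have hq : (j, true) ∈ mixedVars (J.erase j \ J₁) (insert (j, true) (I \ I₁)) := by
        simp [mem_mixedVars]
      have he := card_mixed_exponent_le (m := J.card) (s := I.card) (m₁ := J₁.card)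
        (m₂ := (J.erase j \ J₁).card) (s₁ := I₁.card) (s₂ := (I \ I₁).card)
        (by omega) (by omega)
      have he' := card_mixed_exponent_le (m := J.card) (s := I.card) (m₂ := J₁.card)
        (m₁ := (J.erase j \ J₁).card) (s₂ := I₁.card) (s₁ := (I \ I₁).card)
        (by omega) (by omega)
      rw [hvars] at hv ⊢
      rcases Finset.mem_union.1 hv with hv | hv
      · exact (HasSumBound.linked hK hD hρ₀ hdisj hv hp hq
          (fun b ρ => dependsOn_kernelWeight _ _ b ρ) (kernelWeight_nonneg hK _ _)
          (hb1 v hv) (hb2 _ hq)).mono_exponent hρ₀ he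
      -- The part containing the root must be summed last, so the two parts change roles; evenness
      -- of `K₁` restores the kernel.
      · have h := (HasSumBound.linked hK hD hρ₀ hdisj.symm hv hq hp
          (fun b ρ => dependsOn_kernelWeight _ _ b ρ) (kernelWeight_nonneg hK _ _)
          (hb2 v hv) (hb1 _ hp)).mono_exponent hρ₀ he'
        rw [Finset.union_comm]
        refine h.mono fun b ρ _ _ _ t => le_of_eq ?_
        rw [← hK.even (b * ((t (j, true) : ℝ) - t (j, false))),
          mul_comm (kernelWeight _ _ _ _ J₁ _ _ _ _)]
        congr 2
        ring

end MixedCumulant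

/-! ### Reduction of the estimator cumulants to weighted sums. -/

section SpectralEstimator

variable {Ω : Type*} [MeasurableSpace Ω] {μ : Measure Ω} {r : ℕ} {X : Fin r → ℝ → Ω → ℝ}
  {L : ℕ}

/-- The coefficient of `X_{a₁}(t₁/ρ) X_{a₂}(t₂/ρ)` in the estimator of the spectral density. -/
def specCoeff (K : ℝ → ℝ) (n : ℕ) (b ρ ν : ℝ) (s : ℕ × ℕ) : ℂ :=
  (1 / (2 * (Real.pi : ℂ) * (n : ℂ) * (ρ : ℂ))) * (K (b * ((s.1 : ℝ) - (s.2 : ℝ))) : ℂ) *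
    Complex.exp (-(Complex.I * ((s.1 : ℂ) - (s.2 : ℂ)) * (ν : ℂ) / (ρ : ℂ))) *
    Set.indicator (Set.Icc (-(Real.pi * ρ)) (Real.pi * ρ)) (fun _ => (1 : ℂ)) ν

theorem specEstimator_eq_sum {Ω : Type*} {r : ℕ} (X : Fin r → ℝ → Ω → ℝ) (K : ℝ → ℝ)
    (n : ℕ) (b ρ ν : ℝ) (a₁ a₂ : Fin r) :
    specEstimator X K n b ρ a₁ a₂ ν = fun ω =>
      ∑ s ∈ Finset.Icc 1 n ×ˢ Finset.Icc 1 n, specCoeff K n b ρ ν s *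
        ((X a₁ (s.1 / ρ) ω * X a₂ (s.2 / ρ) ω : ℝ) : ℂ) := by
  ext ω
  rw [specEstimator, Finset.sum_product, Finset.mul_sum]
  refine Finset.sum_congr rfl fun t₁ _ => ?_
  rw [Finset.mul_sum]
  refine Finset.sum_congr rfl fun t₂ _ => ?_
  simp only [specCoeff]
  push_cast
  ring

theorem norm_specCoeff_le {K K₁ : ℝ → ℝ} (hK : ∀ x, |K x| ≤ K₁ x) {n : ℕ} {b ρ : ℝ}
    (hρ : 0 < ρ) (ν : ℝ) (s : ℕ × ℕ) :
    ‖specCoeff K n b ρ ν s‖ ≤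
      (2 * Real.pi * n * ρ)⁻¹ * K₁ (b * ((s.1 : ℝ) - (s.2 : ℝ))) := by
  have hexp : ‖Complex.exp (-(Complex.I * ((s.1 : ℂ) - (s.2 : ℂ)) * (ν : ℂ) / (ρ : ℂ)))‖ = 1 := by
    have : -(Complex.I * ((s.1 : ℂ) - (s.2 : ℂ)) * (ν : ℂ) / (ρ : ℂ)) =
        ((-(((s.1 : ℝ) - s.2) * ν / ρ) : ℝ) : ℂ) * Complex.I := by
      push_cast; ring
    rw [this, Complex.norm_exp_ofReal_mul_I]
  have hind :
      ‖Set.indicator (Set.Icc (-(Real.pi * ρ)) (Real.pi * ρ)) (fun _ => (1 : ℂ)) ν‖ ≤ 1 := by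
    refine (norm_indicator_le_norm_self _ _).trans ?_
    simp
  have hconst : ‖(1 / (2 * (Real.pi : ℂ) * (n : ℂ) * (ρ : ℂ)))‖ = (2 * Real.pi * n * ρ)⁻¹ := by
    have : (1 / (2 * (Real.pi : ℂ) * (n : ℂ) * (ρ : ℂ))) =
        (((2 * Real.pi * n * ρ)⁻¹ : ℝ) : ℂ) := by
      push_cast; ring
    rw [this, Complex.norm_real, Real.norm_of_nonneg]
    have := Real.pi_pos
    positivity
  rw [specCoeff, norm_mul, norm_mul, norm_mul, hexp, hconst, mul_one, Complex.norm_real,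
    Real.norm_eq_abs]
  have hp : 0 ≤ (2 * Real.pi * n * ρ)⁻¹ := by
    have := Real.pi_pos
    positivity
  calc _ ≤ (2 * Real.pi * n * ρ)⁻¹ * |K (b * ((s.1 : ℝ) - (s.2 : ℝ)))| * 1 :=
        mul_le_mul_of_nonneg_left hind (mul_nonneg hp (abs_nonneg _))
    _ ≤ _ := by
        rw [mul_one]
        exact mul_le_mul_of_nonneg_left (hK _) hp

/-- The sampling indices of all pairs, as one family indexed by the variables. -/
def unpair (f : Fin L → ℕ × ℕ) (w : Fin L × Bool) : ℕ :=
  if w.2 then (f w.1).2 else (f w.1).1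

theorem sum_piFinset_unpair {N : Type*} [AddCommMonoid N] (T : Finset ℕ)
    (F : (Fin L × Bool → ℕ) → N) :
    ∑ f ∈ Fintype.piFinset (fun _ : Fin L => T ×ˢ T), F (unpair f) =
      ∑ t ∈ Fintype.piFinset (fun _ : Fin L × Bool => T), F t := by
  refine Finset.sum_nbij' unpair (fun t j => (t (j, false), t (j, true))) ?_ ?_ ?_ ?_ ?_
  · intro f hf
    simp only [Fintype.mem_piFinset, Finset.mem_product] at hf ⊢
    rintro ⟨j, d⟩
    cases d
    · simpa [unpair] using (hf j).1
    · simpa [unpair] using (hf j).2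
  · intro t ht
    simp only [Fintype.mem_piFinset, Finset.mem_product] at ht ⊢
    exact fun j => ⟨ht _, ht _⟩
  · intro f _
    ext j <;> simp [unpair]
  · intro t _
    ext ⟨j, d⟩
    cases d <;> simp [unpair]
  · intro _ _; rfl

/-- The components of the variables of all pairs. -/
def pairComponents (a a' : Fin L → Fin r) (w : Fin L × Bool) : Fin r :=
  if w.2 then a' w.1 else a w.1

theorem jointCumulant_pairs_eq [IsProbabilityMeasure μ] [NeZero L] (a a' : Fin L → Fin r)
    (f : Fin L → ℕ × ℕ) (ρ : ℝ) :
    jointCumulant μ (fun j ω => X (a j) ((f j).1 / ρ) ω * X (a' j) ((f j).2 / ρ) ω) =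
      mixedCumulant μ X (pairComponents a a') Finset.univ ∅ (fun w => unpair f w / ρ) := by
  have h := jointCumulant_eq_setCumulant_map (μ := μ)
    (pairOrSingle X (pairComponents a a') (fun w => unpair f w / ρ))
    (Function.Embedding.inl : Fin L ↪ Fin L ⊕ (Fin L × Bool))
  rw [mixedCumulant, Finset.disjSum_empty, ← h]
  rfl

theorem norm_jointCumulant_specEstimator_le [IsProbabilityMeasure μ] [NeZero L]
    (hX : ∀ a t, X a t ∈ allMoments μ ℝ) {K K₁ : ℝ → ℝ} (hK : ∀ x, |K x| ≤ K₁ x) {n : ℕ}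
    {b ρ : ℝ} (hρ : 0 < ρ) (a a' : Fin L → Fin r) (ν : Fin L → ℝ) :
    ‖jointCumulant μ (fun j : Fin L => specEstimator X K n b ρ (a j) (a' j) (ν j))‖ ≤
      ((2 * Real.pi * n * ρ)⁻¹) ^ L *
        ∑ t ∈ Fintype.piFinset (fun _ : Fin L × Bool => Finset.Icc 1 n),
          kernelWeight μ X (pairComponents a a') K₁ Finset.univ ∅ b ρ t := by
  simp only [specEstimator_eq_sum]
  rw [jointCumulant_sum (Finset.Icc 1 n ×ˢ Finset.Icc 1 n) (fun j => specCoeff K n b ρ (ν j))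
    (fun j s ω => ((X (a j) (s.1 / ρ) ω * X (a' j) (s.2 / ρ) ω : ℝ) : ℂ))
    (fun j s => ofReal_mem_allMoments (mul_mem_allMoments (hX _ _) (hX _ _)))]
  refine (norm_sum_le _ _).trans ?_
  rw [← sum_piFinset_unpair, Finset.mul_sum]
  refine Finset.sum_le_sum fun f _ => ?_
  rw [jointCumulant_ofReal, jointCumulant_pairs_eq, norm_mul, Complex.norm_real,
    Real.norm_eq_abs, kernelWeight, ← mul_assoc, norm_prod]
  refine mul_le_mul_of_nonneg_right ?_ (abs_nonneg _)
  calc _ ≤ ∏ j, ((2 * Real.pi * n * ρ)⁻¹ * K₁ (b * (((f j).1 : ℝ) - ((f j).2 : ℝ)))) :=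
        Finset.prod_le_prod (fun _ _ => norm_nonneg _) fun j _ => norm_specCoeff_le hK hρ _ _
    _ = _ := by
        rw [Finset.prod_mul_distrib]
        simp [unpair]

/-- Only finitely many `n` escape the limit, and their minimum is positive. This makes the final
bound hold for every `n ≥ 1`, not just for large `n`. -/
theorem exists_pos_le_of_tendsto_atTop {ρ : ℕ → ℝ} (hpos : ∀ n, 1 ≤ n → 0 < ρ n)
    (h : Tendsto ρ atTop atTop) : ∃ ρ₀, 0 < ρ₀ ∧ ∀ n, 1 ≤ n → ρ₀ ≤ ρ n := by
  obtain ⟨N, hN⟩ := eventually_atTop.1 (h.eventually_ge_atTop 1)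
  obtain ⟨k, hk, hmin⟩ := Finset.exists_min_image (Finset.Icc 1 (N + 1)) ρ ⟨1, by simp⟩
  refine ⟨min 1 (ρ k), lt_min one_pos (hpos k (Finset.mem_Icc.1 hk).1), fun n hn => ?_⟩
  rcases le_total N n with h' | h'
  · exact (min_le_left _ _).trans (hN n h')
  · exact (min_le_right _ _).trans (hmin n (Finset.mem_Icc.2 ⟨hn, by omega⟩))

end SpectralEstimator

end

/-! ### The cumulant bound. -/

theorem theorem3 {Ω : Type*} [MeasurableSpace Ω] (μ : Measure Ω) [IsProbabilityMeasure μ]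
    {r : ℕ} (X : Fin r → ℝ → Ω → ℝ) (K : ℝ → ℝ) (b ρ : ℕ → ℝ)
    (hX : IsMeanSquareContinuousStationary μ X)
    (hb_pos : ∀ n : ℕ, 1 ≤ n → 0 < b n)
    (hρ_pos : ∀ n : ℕ, 1 ≤ n → 0 < ρ n)
    (h1 : HasIntegrableCovEnvelopes μ X)
    (h2 : IsCovAveragingKernel K)
    (h3 : Tendsto (fun n : ℕ => (n : ℝ) * b n) atTop atTop)
    (h4 : Tendsto ρ atTop atTop)
    (h4' : Tendsto (fun n : ℕ => ρ n * b n) atTop (𝓝 0))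
    (h5 : HasDominatedCumulants μ X)
    (L : ℕ) (hL : 2 < L) (a a' : Fin L → Fin r) :
    ∃ Q : ℝ, ∀ n : ℕ, 1 ≤ n → ∀ ν : Fin L → ℝ,
      ‖jointCumulant μ (fun j : Fin L => specEstimator X K n (b n) (ρ n) (a j) (a' j) (ν j))‖
        ≤ Q * ((n : ℝ) * b n) ^ (-((L : ℤ) - 1)) := by
  obtain ⟨l, rfl⟩ : ∃ l, L = l + 1 := ⟨L - 1, by omega⟩
  obtain ⟨K₁, hK0, hKe, hKi, -, hKa, hKle⟩ := h2.bound
  have hK : IsIntegrableEnvelope K₁ := ⟨hK0, hKe, hKi, hKa⟩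
  have hmom : ∀ a t, X a t ∈ allMoments μ ℝ := fun a t =>
    mem_allMoments_of_integrable_pow (hX.measurable a t) fun k hk => h5.moments k hk a t
  obtain ⟨ρ₀, hρ₀, hρle⟩ := exists_pos_le_of_tendsto_atTop hρ_pos h4
  obtain ⟨D₀, hD₀⟩ := h4'.bddAbove_range
  have hDle : ∀ n, ρ n * b n ≤ max D₀ 1 := fun n =>
    (hD₀ ⟨n, rfl⟩).trans (le_max_left _ _)
  have hD : 0 < max D₀ 1 := lt_max_of_lt_right one_pos
  generalize max D₀ 1 = D at hDle hD
  have hvars : mixedVars (Finset.univ : Finset (Fin (l + 1))) ∅ = Finset.univ := by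
    ext w; simp [mem_mixedVars]
  obtain ⟨C, hC, H⟩ := hasSumBound_kernelWeight (c := pairComponents a a') hX h1 h5 hK hD hρ₀
    (l + 1) Finset.univ ∅ (by simp) (by simp) ((0 : Fin (l + 1)), false) (by simp [mem_mixedVars])
  have hcard : ((Finset.univ : Finset (Fin (l + 1) × Bool)).erase (0, false)).card =
      2 * l + 1 := by
    rw [Finset.card_erase_of_mem (Finset.mem_univ _), Finset.card_univ, Fintype.card_prod,
      Fintype.card_fin, Fintype.card_bool]
    omega
  -- One `(2π)⁻¹` per estimator, `C` from the power counting, and `D ^ l` from `(D / (ρ * b)) ^ l`;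
  -- all powers of `ρ n` cancel.
  refine ⟨((2 * Real.pi)⁻¹) ^ (l + 1) * C * D ^ l, fun n hn ν => ?_⟩
  have hb := hb_pos n hn
  have hρ := hρ_pos n hn
  have hn0 : (0 : ℝ) < n := by exact_mod_cast hn
  have hsum := sum_piFinset_le (Finset.Icc 1 n) ((0 : Fin (l + 1)), false) _ _ fun t => by
    have h := H n (b n) (ρ n) hb (hρle n hn) (hDle n) t
    rw [hvars] at h
    exact h
  rw [hcard, Nat.card_Icc] at hsum
  refine (norm_jointCumulant_specEstimator_le hmom hKle hρ a a' ν).trans ?_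
  have hpi := Real.pi_pos
  refine (mul_le_mul_of_nonneg_left hsum (by positivity)).trans_eq ?_
  have he1 : (((Finset.univ : Finset (Fin (l + 1))).card : ℤ) -
      if (∅ : Finset (Fin (l + 1) × Bool)).card ≤ 1 then 1 else 0) = (l : ℤ) := by
    simp
  have he2 : -(((l + 1 : ℕ) : ℤ) - 1) = -(l : ℤ) := by push_cast; ring
  rw [he1, he2, zpow_neg, zpow_natCast, zpow_natCast, Nat.add_sub_cancel]
  simp only [inv_pow, div_pow, mul_pow]
  field_simp
  ring
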